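/- Let $N\ge 1$ be an integer and let $p\in\mathbb{R}$ satisfy $\frac{2N}{N+1}<p<2$. For $a>0$ consider the initial value problem $$(|f'|^{p-2}f')'(r)+\frac{N-1}{r}\,(|f'|^{p-2}f')(r)+f(r)-|f'(r)|^{p-1}=0,\qquad r>0,$$ $$f(0)=a,\qquad f'(0)=0,$$ where $|f'|^{p-2}f'$ is understood to be $0$ where $f'=0$. For every $a>0$ there is a unique solution $f(\cdot;a)\in C^1([0,\infty))$ of this problem such that $(|f'|^{p-2}f')(\cdot;a)\in C^1([0,\infty))$. Furthermore, there is a unique $a_*>0$ such that $f(r;a_*)>0$ for all $r\ge 0$ and, for some $c_*>0$, $$f(r;a_*)\sim c_*\,r^{-(N-1)/(p-1)}\,e^{-r/(p-1)}\qquad\text{as } r\to\infty.$$ Moreover: (a) For every $a\in(0,a_*)$, $f(r;a)>0$ for all $r\ge 0$ and $$f(r;a)\sim\left(\frac{2-p}{p-1}\,r\right)^{-(p-1)/(2-p)}\qquad\text{as } r\to\infty.$$ (b) For every $a\in(a_*,\infty)$ there is $R(a)\in(0,\infty)$ such that $f(r;a)>0$ for $r\in(0,R(a))$, $f(R(a);a)=0$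 and $f'(R(a);a)<0$. In particular, $f(\cdot;a)$ changes sign in $(0,\infty)$. -/

import Mathlib

open Set Filter

noncomputable section

/-- The derivative `f'` on `[0,∞)`: one-sided at `0`, the usual derivative on `(0,∞)`. -/
def radialDeriv (f : ℝ → ℝ) (r : ℝ) : ℝ :=
  derivWithin f (Ici 0) r

/-- The flux `|f'|^{p-2} f'`. For `1 < p < 2` its value is `0` where `f' = 0`
(since `Real.rpow` has `0 ^ (p - 2) = 0`, and anyway the second factor vanishes). -/
def flux (p : ℝ) (f : ℝ → ℝ) (r : ℝ) : ℝ :=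
  |radialDeriv f r| ^ (p - 2) * radialDeriv f r

/-- `f` is a global solution of
`(|f'|^{p-2} f')' + ((N-1)/r) |f'|^{p-2} f' + f - |f'|^{p-1} = 0` on `(0,∞)`,
`f(0) = a`, `f'(0) = 0`, such that `f` and `|f'|^{p-2} f'` both belong to `C¹([0,∞))`.
Only the values of `f` on `[0,∞)` matter. -/
structure IsProfile (N : ℕ) (p a : ℝ) (f : ℝ → ℝ) : Prop where
  contDiffOn : ContDiffOn ℝ 1 f (Ici 0)
  contDiffOn_flux : ContDiffOn ℝ 1 (flux p f) (Ici 0)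
  ode : ∀ r : ℝ, 0 < r →
    radialDeriv (flux p f) r + ((N : ℝ) - 1) / r * flux p f r + f r
      - |radialDeriv f r| ^ (p - 1) = 0
  init : f 0 = a
  init_deriv : radialDeriv f 0 = 0

/-- `f` is positive on `[0,∞)` and, for some `c > 0`,
`f(r) ∼ c r^{-(N-1)/(p-1)} e^{-r/(p-1)}` as `r → ∞`. -/
def IsFastDecaying (N : ℕ) (p : ℝ) (f : ℝ → ℝ) : Prop :=
  (∀ r : ℝ, 0 ≤ r → 0 < f r) ∧
    ∃ c : ℝ, 0 < c ∧
      Asymptotics.IsEquivalent atTop f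
        (fun r : ℝ => c * r ^ (-(((N : ℝ) - 1) / (p - 1))) * Real.exp (-(r / (p - 1))))

end

/-!
With `m = 1 / (p - 1) > 1`, `n = N - 1` and `v = -|f'| ^ (p - 2) f'`, the profile equation becomes
the first order system `f' = -|v| ^ (m - 1) v`, `v' + (n / r) v = f - |v|`, in which the
absorption term is linear; this is `IsFlow`. The condition `p > 2 N / (N + 1)` means
`p > 1` and `n m < n + 2`.

*Well-posedness.* The singular term is inverted by an averaging operator, so solutions are fixed
points of a Volterra map, a contraction in a suitable weighted sup norm; the energy
`f² / 2 + |v| ^ (m + 1) / (m + 1)` grows at most exponentially and gives global existence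
(`exists_isFlow`). Since the singular term has a favourable sign, differences of solutions satisfy a
Gronwall inequality, which gives uniqueness and continuous dependence on `a`
(`IsFlow.sq_add_sq_le`).

*Trichotomy.* While `f > 0` one has `v > 0`, and with `ρ = rⁿ eʳ` the equation reads
`(ρ v)' = ρ f`, `f' = -v ^ m`. A solution either crosses zero, or enters an invariant region
`σ v ≤ f` with `f` small (`IsFlow.pos_and_le_of_region`), or is positive with `ρ v` bounded
(`IsFlow.isFast_or_entersRegion`). The first two cases are open in `a`; the first one occurs for
large `a` (`IsFlow.exists_not_pos`, by scaling) and the second one for small `a`. By connectedness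
the third case, fast decay, occurs for some `a` (`IsFlow.exists_isFast`). In the third case `f` is
asymptotic to a multiple of `ρ ^ (-m)` by l'Hôpital's rule. In the second case `v / f → 1`, so
`(f ^ (1 - m))' → m - 1`, which is the algebraic decay.

*Classification.* The functional
`Q = ∫ρ · (f² + 2 / (m + 1) v ^ (m + 1)) - ρ v f` satisfies `Q' = ρ v ^ (m + 1) G(r)` with a strictly
decreasing `G`. For a fast decaying solution `Q` tends to `0` at both ends, so `Q > 0`
(`IsFast.pohozaev_pos`). Let `(f, v)` decay fast and let `(g, w)` be any other solution with a
different initial value, `q = w / v`. Because `Q'` has only a term of degree `m + 1`, the gap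
`X = q ^ (m + 1) Q(f, v) - Q(g, w)` satisfies `X' = (m + 1) q ^ m q' Q(f, v)`, so `X` is monotone
together with `q`. At a first critical point of `q` the two solutions are proportional and `X` can be
computed there; it has the wrong sign. Thus `q` is strictly monotone as long as `g > 0`
(`IsFast.sign_mul_cross_neg`). This excludes a second fast decaying solution, forces solutions
with larger initial value to cross zero, and prevents those with smaller initial value from doing so.
-/

open Topology

/-! ### The signed power -/

/-- The odd extension `x ↦ |x| ^ (m - 1) * x` of `x ↦ x ^ m`. -/
noncomputable def sPow (m x : ℝ) : ℝ := |x| ^ (m - 1) * x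

lemma sPow_of_nonneg {m x : ℝ} (hm : 1 < m) (hx : 0 ≤ x) : sPow m x = x ^ m := by
  rcases hx.eq_or_lt with rfl | hx
  · simp [sPow, Real.zero_rpow (by linarith : m ≠ 0)]
  · rw [sPow, abs_of_pos hx, ← Real.rpow_add_one hx.ne']; simp

lemma sPow_zero (m : ℝ) : sPow m 0 = 0 := by simp [sPow]

lemma sPow_eq_sub {m : ℝ} (hm : 1 < m) (x : ℝ) :
    sPow m x = (max x 0) ^ m - (max (-x) 0) ^ m := by
  have h0 : (0 : ℝ) ^ m = 0 := Real.zero_rpow (by linarith)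
  rcases le_total 0 x with hx | hx
  · rw [sPow_of_nonneg hm hx, max_eq_left hx, max_eq_right (by linarith), h0, sub_zero]
  · rw [max_eq_right hx, max_eq_left (by linarith), h0, zero_sub,
      ← sPow_of_nonneg hm (by linarith : 0 ≤ -x)]
    simp [sPow]

lemma continuous_sPow {m : ℝ} (hm : 1 < m) : Continuous (sPow m) := by
  unfold sPow
  exact (continuous_abs.rpow_const fun x => Or.inr (by linarith)).mul continuous_id

lemma abs_rpow_sub_rpow_le {m M x y : ℝ} (hm : 1 < m) (hx : x ∈ Icc 0 M) (hy : y ∈ Icc 0 M) :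
    |x ^ m - y ^ m| ≤ m * M ^ (m - 1) * |x - y| := by
  have := (convex_Icc (0 : ℝ) M).norm_image_sub_le_of_norm_hasDerivWithin_le
    (f := fun x => x ^ m) (f' := fun x => m * x ^ (m - 1)) (C := m * M ^ (m - 1))
    (fun z _ => (Real.hasDerivAt_rpow_const (Or.inr hm.le)).hasDerivWithinAt)
    (fun z hz => by
      rw [Real.norm_eq_abs, abs_of_nonneg (mul_nonneg (by linarith) (Real.rpow_nonneg hz.1 _))]
      exact mul_le_mul_of_nonneg_left (Real.rpow_le_rpow hz.1 hz.2 (by linarith)) (by linarith))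
    hy hx
  simpa [Real.norm_eq_abs] using this

lemma abs_sPow_sub_le {m M x y : ℝ} (hm : 1 < m) (hx : |x| ≤ M) (hy : |y| ≤ M) :
    |sPow m x - sPow m y| ≤ 2 * (m * M ^ (m - 1)) * |x - y| := by
  have hM : 0 ≤ M := (abs_nonneg x).trans hx
  rw [abs_le] at hx hy
  have hC : 0 ≤ m * M ^ (m - 1) := mul_nonneg (by linarith) (Real.rpow_nonneg hM _)
  have h1 := abs_rpow_sub_rpow_le (M := M) hm (x := max x 0) (y := max y 0)
    ⟨le_max_right _ _, max_le hx.2 hM⟩ ⟨le_max_right _ _, max_le hy.2 hM⟩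
  have h2 := abs_rpow_sub_rpow_le (M := M) hm (x := max (-x) 0) (y := max (-y) 0)
    ⟨le_max_right _ _, max_le (by linarith) hM⟩ ⟨le_max_right _ _, max_le (by linarith) hM⟩
  have h3 : |max x 0 - max y 0| ≤ |x - y| := abs_max_sub_max_le_abs x y 0
  have h4 : |max (-x) 0 - max (-y) 0| ≤ |x - y| := by
    refine (abs_max_sub_max_le_abs (-x) (-y) 0).trans_eq ?_
    rw [← abs_neg]; congr 1; ring
  rw [sPow_eq_sub hm, sPow_eq_sub hm]
  calc _ = |((max x 0) ^ m - (max y 0) ^ m) - ((max (-x) 0) ^ m - (max (-y) 0) ^ m)| := by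
        congr 1; ring
    _ ≤ _ := abs_sub _ _
    _ ≤ _ := by
        have := mul_le_mul_of_nonneg_left h3 hC
        have := mul_le_mul_of_nonneg_left h4 hC
        linarith

lemma hasDerivAt_abs_rpow_div {m : ℝ} (hm : 1 < m) (x : ℝ) :
    HasDerivAt (fun x : ℝ => |x| ^ (m + 1) / (m + 1)) (sPow m x) x := by
  refine ((hasDerivAt_abs_rpow x (p := m + 1) (by linarith)).div_const (m + 1)).congr_deriv ?_
  rw [sPow, show m + 1 - 2 = m - 1 by ring]
  field_simp

/-- Bound for the derivative of `f² / 2 + |v| ^ (m + 1) / (m + 1)` along the first order system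
below. -/
lemma energy_deriv_le (m x y : ℝ) (hm : 1 < m) {c : ℝ} (hc : 0 ≤ c) :
    x * -sPow m y + sPow m y * (x - |y| - c * y) ≤ |y| ^ (m + 1) := by
  have e1 : |y| ^ (m + 1) = |y| ^ (m - 1) * y ^ 2 := by
    rw [← sq_abs, ← Real.rpow_natCast, ← Real.rpow_add' (abs_nonneg _) (by push_cast; linarith)]
    congr 1; push_cast; ring
  have e2 : 0 ≤ |y| ^ (m - 1) := Real.rpow_nonneg (abs_nonneg _) _
  have e3 : -(y * |y|) ≤ y ^ 2 := by nlinarith [sq_abs y, neg_abs_le y, abs_nonneg y]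
  have e4 := mul_le_mul_of_nonneg_left e3 e2
  have e5 : 0 ≤ |y| ^ (m - 1) * y ^ 2 * c := by positivity
  rw [e1, sPow]
  linarith

lemma abs_rpow_le_of_energy_le {m x y B : ℝ} (hm : 1 < m)
    (h : x ^ 2 / 2 + |y| ^ (m + 1) / (m + 1) ≤ B) : |y| ^ (m + 1) ≤ (m + 1) * B := by
  have h1 : |y| ^ (m + 1) / (m + 1) ≤ B := by linarith [sq_nonneg x]
  rwa [div_le_iff₀' (by linarith)] at h1

lemma abs_le_of_energy_le {m x y B : ℝ} (hm : 1 < m)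
    (h : x ^ 2 / 2 + |y| ^ (m + 1) / (m + 1) ≤ B) : |y| ≤ ((m + 1) * B) ^ (1 / (m + 1)) := by
  have h2 := Real.rpow_le_rpow (by positivity) (abs_rpow_le_of_energy_le hm h)
    (by positivity : 0 ≤ 1 / (m + 1))
  rwa [← Real.rpow_mul (abs_nonneg _), mul_one_div_cancel (by linarith), Real.rpow_one] at h2

/-! ### A singular Volterra system -/

/-- The map whose fixed points solve the integral form of `f' = -ψ(r, v)`,
`v' + (n / r) v = f - |v|`, `f 0 = a`, in the unknown `u = exp (-Λ) (f, v)`. The average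
`r ∫₀¹ tⁿ g(rt) dt` is the solution of `v' + (n / r) v = g` that is regular at the origin. The
argument is clamped to `[0, ∞)` so that the map acts on functions on the whole line. -/
noncomputable def volterraMap (n : ℕ) (a : ℝ) (ψ : ℝ → ℝ → ℝ) (Λ : ℝ → ℝ) (u : ℝ → ℝ × ℝ)
    (r : ℝ) : ℝ × ℝ :=
  (Real.exp (-Λ (max r 0)) *
      (a - ∫ s in (0 : ℝ)..(max r 0), ψ s (Real.exp (Λ s) * (u s).2)),
   Real.exp (-Λ (max r 0)) * (max r 0 * ∫ t in (0 : ℝ)..1, t ^ n *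
      (Real.exp (Λ (max r 0 * t)) * (u (max r 0 * t)).1
        - |Real.exp (Λ (max r 0 * t)) * (u (max r 0 * t)).2|)))

section Volterra

variable {n : ℕ} {a : ℝ} {ψ : ℝ → ℝ → ℝ} {Λ L : ℝ → ℝ}

lemma continuous_volterraMap (hψ : Continuous (Function.uncurry ψ)) (hΛ : Continuous Λ)
    {u : ℝ → ℝ × ℝ} (hu : Continuous u) : Continuous (volterraMap n a ψ Λ u) := by
  have hm : Continuous fun r : ℝ => max r 0 := by fun_prop
  have h1 : Continuous fun s => ψ s (Real.exp (Λ s) * (u s).2) :=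
    hψ.comp (by fun_prop : Continuous fun s => (s, Real.exp (Λ s) * (u s).2))
  have h2 : Continuous fun r => ∫ s in (0 : ℝ)..r, ψ s (Real.exp (Λ s) * (u s).2) :=
    intervalIntegral.continuous_primitive (fun _ _ => h1.intervalIntegrable _ _) 0
  have h3 : Continuous fun r => ∫ t in (0 : ℝ)..1, t ^ n *
      (Real.exp (Λ (r * t)) * (u (r * t)).1 - |Real.exp (Λ (r * t)) * (u (r * t)).2|) := by
    apply intervalIntegral.continuous_parametric_intervalIntegral_of_continuous'
    simp only [Function.uncurry_def]
    fun_prop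
  unfold volterraMap
  refine Continuous.prodMk ?_ ?_
  · exact (by fun_prop : Continuous fun r => Real.exp (-Λ (max r 0))).mul
      (continuous_const.sub (h2.comp hm))
  · exact (by fun_prop : Continuous fun r => Real.exp (-Λ (max r 0))).mul (hm.mul (h3.comp hm))

/-- The weight `Λ = 2 ∫ L` makes the Volterra map a contraction with constant `1 / 2`. -/
lemma norm_volterraMap_sub_le (hψ : Continuous (Function.uncurry ψ)) (hL : Continuous L)
    (hL2 : ∀ s, 2 ≤ L s) (hLip : ∀ s x y, |ψ s x - ψ s y| ≤ L s * |x - y|)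
    (hΛ : ∀ r, HasDerivAt Λ (2 * L r) r) (hΛ0 : Λ 0 = 0)
    {u w : ℝ → ℝ × ℝ} (hu : Continuous u) (hw : Continuous w) {D : ℝ}
    (hD : ∀ s, ‖u s - w s‖ ≤ D) (r : ℝ) :
    ‖volterraMap n a ψ Λ u r - volterraMap n a ψ Λ w r‖ ≤ D / 2 := by
  have hΛc : Continuous Λ := continuous_iff_continuousAt.2 fun r => (hΛ r).continuousAt
  have hD0 : 0 ≤ D := (norm_nonneg _).trans (hD 0)
  set x := max r 0 with hx
  have hx0 : 0 ≤ x := le_max_right _ _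
  have hI : ∫ s in (0 : ℝ)..x, L s * (Real.exp (Λ s) * D) = D / 2 * (Real.exp (Λ x) - 1) := by
    rw [intervalIntegral.integral_eq_sub_of_hasDerivAt
      (f := fun s => D / 2 * Real.exp (Λ s))]
    · simp [hΛ0]; ring
    · intro s _
      refine ((hΛ s).exp.const_mul (D / 2)).congr_deriv ?_
      ring
    · exact (by fun_prop : Continuous fun s => L s * (Real.exp (Λ s) * D)).intervalIntegrable _ _
  have hfin : Real.exp (-Λ x) * (D / 2 * (Real.exp (Λ x) - 1)) ≤ D / 2 := by
    have h1 : Real.exp (-Λ x) * Real.exp (Λ x) = 1 := by rw [← Real.exp_add]; simp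
    have h2 := Real.exp_pos (-Λ x)
    have : Real.exp (-Λ x) * (D / 2 * (Real.exp (Λ x) - 1))
      = D / 2 * (Real.exp (-Λ x) * Real.exp (Λ x)) - D / 2 * Real.exp (-Λ x) := by ring
    rw [this, h1]
    have := mul_nonneg (by linarith : 0 ≤ D / 2) h2.le
    linarith
  have c1 : ∀ {u : ℝ → ℝ × ℝ}, Continuous u →
      Continuous fun s => ψ s (Real.exp (Λ s) * (u s).2) := fun {u} hu =>
    hψ.comp (by fun_prop : Continuous fun s => (s, Real.exp (Λ s) * (u s).2))
  have hd1 : ∀ s, |(u s).1 - (w s).1| ≤ D := fun s => (norm_fst_le (u s - w s)).trans (hD s)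
  have hd2 : ∀ s, |(u s).2 - (w s).2| ≤ D := fun s => (norm_snd_le (u s - w s)).trans (hD s)
  have hcI : Continuous fun s => L s * (Real.exp (Λ s) * D) := by fun_prop
  rw [Prod.norm_def]
  refine max_le ?_ ?_
  · simp only [volterraMap, ← hx, Prod.fst_sub]
    rw [← mul_sub, norm_mul, Real.norm_of_nonneg (Real.exp_pos _).le]
    refine le_trans (mul_le_mul_of_nonneg_left ?_ (Real.exp_pos _).le) hfin
    rw [sub_sub_sub_cancel_left, ← intervalIntegral.integral_sub
      ((c1 hw).intervalIntegrable _ _) ((c1 hu).intervalIntegrable _ _), ← hI]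
    refine intervalIntegral.norm_integral_le_of_norm_le hx0 (.of_forall fun s _ => ?_)
      (hcI.intervalIntegrable _ _)
    refine (hLip _ _ _).trans (mul_le_mul_of_nonneg_left ?_ (by linarith [hL2 s]))
    rw [← mul_sub, abs_mul, abs_of_pos (Real.exp_pos _), abs_sub_comm]
    exact mul_le_mul_of_nonneg_left (hd2 s) (Real.exp_pos _).le
  · simp only [volterraMap, ← hx, Prod.snd_sub]
    rw [← mul_sub, norm_mul, Real.norm_of_nonneg (Real.exp_pos _).le]
    refine le_trans (mul_le_mul_of_nonneg_left ?_ (Real.exp_pos _).le) hfin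
    have c2 : ∀ {u : ℝ → ℝ × ℝ}, Continuous u → Continuous fun t => t ^ n *
      (Real.exp (Λ (x * t)) * (u (x * t)).1 - |Real.exp (Λ (x * t)) * (u (x * t)).2|) := by
      intro u hu; fun_prop
    rw [← mul_sub, ← intervalIntegral.integral_sub ((c2 hu).intervalIntegrable _ _)
      ((c2 hw).intervalIntegrable _ _), norm_mul, Real.norm_of_nonneg hx0, ← hI]
    have hcomp : ∫ s in (0 : ℝ)..x, L s * (Real.exp (Λ s) * D)
        = x * ∫ t in (0 : ℝ)..1, L (x * t) * (Real.exp (Λ (x * t)) * D) := by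
      rw [intervalIntegral.mul_integral_comp_mul_left
        (f := fun s => L s * (Real.exp (Λ s) * D))]
      simp
    rw [hcomp]
    refine mul_le_mul_of_nonneg_left ?_ hx0
    refine intervalIntegral.norm_integral_le_of_norm_le zero_le_one (.of_forall fun t ht => ?_)
      ((by fun_prop : Continuous fun t => L (x * t) * (Real.exp (Λ (x * t)) * D)).intervalIntegrable
        _ _)
    have ht1 : t ^ n ≤ 1 := pow_le_one₀ ht.1.le ht.2
    have ht0 : 0 ≤ t ^ n := pow_nonneg ht.1.le n
    rw [← mul_sub, norm_mul, Real.norm_of_nonneg ht0]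
    have e := Real.exp_pos (Λ (x * t))
    have hb : ‖Real.exp (Λ (x * t)) * (u (x * t)).1 - |Real.exp (Λ (x * t)) * (u (x * t)).2|
        - (Real.exp (Λ (x * t)) * (w (x * t)).1 - |Real.exp (Λ (x * t)) * (w (x * t)).2|)‖
        ≤ 2 * (Real.exp (Λ (x * t)) * D) := by
      rw [abs_mul, abs_mul, abs_of_pos e]
      have h1 := hd1 (x * t)
      have h2 := (abs_abs_sub_abs_le (u (x * t)).2 (w (x * t)).2).trans (hd2 (x * t))
      rw [show ∀ A b c d e : ℝ, A * b - A * c - (A * d - A * e) = A * ((b - d) - (c - e)) by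
        intros; ring, norm_mul, Real.norm_of_nonneg e.le]
      have h3 : ‖((u (x * t)).1 - (w (x * t)).1) - (|(u (x * t)).2| - |(w (x * t)).2|)‖ ≤ 2 * D :=
        (norm_sub_le _ _).trans (by simp only [Real.norm_eq_abs]; linarith)
      nlinarith
    have hb2 : 2 * (Real.exp (Λ (x * t)) * D) ≤ L (x * t) * (Real.exp (Λ (x * t)) * D) :=
      mul_le_mul_of_nonneg_right (hL2 _) (by positivity)
    calc _ ≤ 1 * (L (x * t) * (Real.exp (Λ (x * t)) * D)) := by
          gcongr
          exact hb.trans hb2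
      _ = _ := one_mul _

theorem exists_volterra_solution (n : ℕ) (a : ℝ) (hψ : Continuous (Function.uncurry ψ))
    (hψ0 : ∀ s, ψ s 0 = 0) (hL : Continuous L)
    (hL2 : ∀ s, 2 ≤ L s) (hLip : ∀ s x y, |ψ s x - ψ s y| ≤ L s * |x - y|) :
    ∃ f v : ℝ → ℝ, Continuous f ∧ Continuous v ∧
      (∀ r, 0 ≤ r → f r = a - ∫ s in (0 : ℝ)..r, ψ s (v s)) ∧
      (∀ r, 0 ≤ r → v r = r * ∫ t in (0 : ℝ)..1, t ^ n * (f (r * t) - |v (r * t)|)) := by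
  set Λ : ℝ → ℝ := fun r => ∫ s in (0 : ℝ)..r, 2 * L s with hΛdef
  have hΛ : ∀ r, HasDerivAt Λ (2 * L r) r := fun r =>
    (by fun_prop : Continuous fun s => 2 * L s).integral_hasStrictDerivAt 0 r |>.hasDerivAt
  have hΛ0 : Λ 0 = 0 := by simp [hΛdef]
  have hΛc : Continuous Λ := continuous_iff_continuousAt.2 fun r => (hΛ r).continuousAt
  have hΛn : ∀ r, 0 ≤ r → 0 ≤ Λ r := fun r hr =>
    intervalIntegral.integral_nonneg hr fun s _ => by linarith [hL2 s]
  have key := fun {u w : ℝ → ℝ × ℝ} => norm_volterraMap_sub_le (n := n) (a := a) hψ hL hL2 hLip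
    hΛ hΛ0 (u := u) (w := w)
  have hzero : ∀ r, ‖volterraMap n a ψ Λ (fun _ => 0) r‖ ≤ |a| := by
    intro r
    rw [Prod.norm_def]
    refine max_le ?_ ?_
    · simp only [volterraMap, Prod.snd_zero, mul_zero, hψ0]
      rw [intervalIntegral.integral_zero, sub_zero, norm_mul, Real.norm_of_nonneg (Real.exp_pos _).le]
      have : Real.exp (-Λ (max r 0)) ≤ 1 :=
        Real.exp_le_one_iff.2 (by linarith [hΛn _ (le_max_right r 0)])
      exact mul_le_of_le_one_left (norm_nonneg _) this
    · simp [volterraMap]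
  let T : BoundedContinuousFunction ℝ (ℝ × ℝ) → BoundedContinuousFunction ℝ (ℝ × ℝ) := fun u =>
    BoundedContinuousFunction.ofNormedAddCommGroup (volterraMap n a ψ Λ u)
      (continuous_volterraMap hψ hΛc u.continuous) (|a| + ‖u‖ / 2) fun r => by
        have h1 := key u.continuous (continuous_const : Continuous fun _ : ℝ => (0 : ℝ × ℝ))
          (D := ‖u‖) (fun s => by simpa using u.norm_coe_le_norm s) r
        have h2 := hzero r
        calc _ = ‖volterraMap n a ψ Λ (fun _ => 0) r + (volterraMap n a ψ Λ u r
              - volterraMap n a ψ Λ (fun _ => 0) r)‖ := by congr 1; abel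
          _ ≤ _ := (norm_add_le _ _).trans (add_le_add h2 h1)
  have hT : ContractingWith (1 / 2) T := by
    refine ⟨by rw [← NNReal.coe_lt_coe]; norm_num, LipschitzWith.of_dist_le_mul fun u w => ?_⟩
    rw [BoundedContinuousFunction.dist_le (by positivity)]
    intro r
    rw [dist_eq_norm]
    refine (key u.continuous w.continuous (D := dist u w) (fun s => ?_) r).trans_eq ?_
    · rw [← dist_eq_norm]; exact BoundedContinuousFunction.dist_coe_le_dist s
    · simp; ring
  obtain ⟨u, hu⟩ : ∃ u, T u = u := ⟨_, hT.fixedPoint_isFixedPt⟩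
  have hu' : ∀ r, 0 ≤ r → u r = volterraMap n a ψ Λ u r := fun r _ =>
    (DFunLike.congr_fun hu r).symm
  have hee : ∀ x, Real.exp (Λ x) * Real.exp (-Λ x) = 1 := fun x => by rw [← Real.exp_add]; simp
  have huc : Continuous u := u.continuous
  refine ⟨fun s => Real.exp (Λ s) * (u s).1, fun s => Real.exp (Λ s) * (u s).2,
    by fun_prop, by fun_prop, fun r hr => ?_, fun r hr => ?_⟩
  · have := congrArg Prod.fst (hu' r hr)
    simp only [volterraMap, max_eq_left hr] at this
    beta_reduce
    rw [this, ← mul_assoc, hee, one_mul]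
  · have := congrArg Prod.snd (hu' r hr)
    simp only [volterraMap, max_eq_left hr] at this
    beta_reduce
    rw [this, ← mul_assoc, hee, one_mul]

end Volterra

/-! ### The first order system -/

/-- The first order system `f' = -|v| ^ (m - 1) v`, `v' = f - |v| - (n / r) v` on `[0, ∞)` with
`f 0 = a` and `v 0 = 0`. With `m = 1 / (p - 1)` and `n = N - 1` it is the profile equation
written for `f` and `v = -|f'| ^ (p - 2) f'`. The value `a / (n + 1)` of `v' 0`, forced by letting
`r → 0` in the equation, is part of the structure. -/
structure IsFlow (n : ℕ) (m a : ℝ) (f v : ℝ → ℝ) : Prop where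
  f_zero : f 0 = a
  v_zero : v 0 = 0
  deriv_f : ∀ r, 0 ≤ r → HasDerivWithinAt f (-sPow m (v r)) (Ici 0) r
  deriv_v : ∀ r, 0 < r → HasDerivAt v (f r - |v r| - n / r * v r) r
  deriv_v_zero : HasDerivWithinAt v (a / (n + 1)) (Ici 0) 0

section Regularity

variable {n : ℕ} {a : ℝ} {f v : ℝ → ℝ}

lemma hasDerivAt_mul_average {g : ℝ → ℝ} (hg : Continuous g) {r : ℝ} (hr : 0 < r) (n : ℕ) :
    HasDerivAt (fun r => r * ∫ t in (0 : ℝ)..1, t ^ n * g (r * t))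
      (g r - n / r * (r * ∫ t in (0 : ℝ)..1, t ^ n * g (r * t))) r := by
  have hrep : ∀ x : ℝ, 0 < x → x * ∫ t in (0 : ℝ)..1, t ^ n * g (x * t)
      = (∫ s in (0 : ℝ)..x, s ^ n * g s) / x ^ n := by
    intro x hx
    rw [eq_div_iff (by positivity)]
    have := intervalIntegral.mul_integral_comp_mul_left (a := 0) (b := 1)
      (f := fun s => s ^ n * g s) x
    simp only [mul_zero, mul_one, mul_pow] at this
    rw [← this, mul_assoc, ← intervalIntegral.integral_mul_const]
    congr 2
    ext t; ring
  have hd : HasDerivAt (fun x => ∫ s in (0 : ℝ)..x, s ^ n * g s) (r ^ n * g r) r :=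
    (by fun_prop : Continuous fun s => s ^ n * g s).integral_hasStrictDerivAt 0 r |>.hasDerivAt
  have h1 := hd.div (hasDerivAt_pow n r) (by positivity)
  rw [hrep r hr]
  refine (h1.congr_of_eventuallyEq ?_).congr_deriv ?_
  · filter_upwards [lt_mem_nhds hr] with x hx using hrep x hx
  · rcases n with _ | n
    · simp
    · simp only [Nat.add_sub_cancel]
      field_simp
      ring

lemma continuous_average {g : ℝ → ℝ} (hg : Continuous g) (n : ℕ) :
    Continuous fun r : ℝ => ∫ t in (0 : ℝ)..1, t ^ n * g (r * t) := by
  apply intervalIntegral.continuous_parametric_intervalIntegral_of_continuous'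
  simp only [Function.uncurry_def]
  fun_prop

lemma hasDerivAt_mul_average_zero {g : ℝ → ℝ} (hg : Continuous g) (n : ℕ) :
    HasDerivAt (fun r => r * ∫ t in (0 : ℝ)..1, t ^ n * g (r * t)) (g 0 / (n + 1)) 0 := by
  rw [hasDerivAt_iff_tendsto_slope]
  have h := ((continuous_average hg n).tendsto 0).mono_left (nhdsWithin_le_nhds (s := {0}ᶜ))
  have h0 : ∫ t in (0 : ℝ)..1, t ^ n * g (0 * t) = g 0 / (n + 1) := by
    simp [intervalIntegral.integral_mul_const, integral_pow]; ring
  rw [h0] at h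
  refine h.congr' ?_
  filter_upwards [self_mem_nhdsWithin] with x hx
  have : x ≠ 0 := hx
  simp [slope_def_field, this]

end Regularity

lemma hasDeriv_of_volterra {n : ℕ} {a : ℝ} {ψ : ℝ → ℝ → ℝ} {f v : ℝ → ℝ}
    (hψ : Continuous (Function.uncurry ψ)) (hf : Continuous f) (hv : Continuous v)
    (hfi : ∀ r, 0 ≤ r → f r = a - ∫ s in (0 : ℝ)..r, ψ s (v s))
    (hvi : ∀ r, 0 ≤ r → v r = r * ∫ t in (0 : ℝ)..1, t ^ n * (f (r * t) - |v (r * t)|)) :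
    f 0 = a ∧ v 0 = 0 ∧ (∀ r, 0 ≤ r → HasDerivWithinAt f (-ψ r (v r)) (Ici 0) r) ∧
      (∀ r, 0 < r → HasDerivAt v (f r - |v r| - n / r * v r) r) ∧
      HasDerivWithinAt v (a / (n + 1)) (Ici 0) 0 := by
  have hf0 : f 0 = a := by simpa using hfi 0 le_rfl
  have hv0 : v 0 = 0 := by simpa using hvi 0 le_rfl
  have hg : Continuous fun r => f r - |v r| := by fun_prop
  have hψv : Continuous fun s => ψ s (v s) :=
    hψ.comp (by fun_prop : Continuous fun s => (s, v s))
  refine ⟨hf0, hv0, fun r hr => ?_, fun r hr => ?_, ?_⟩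
  · have h1 : HasDerivAt (fun r => a - ∫ s in (0 : ℝ)..r, ψ s (v s)) (-ψ r (v r)) r :=
      (hψv.integral_hasStrictDerivAt 0 r).hasDerivAt.const_sub a
    exact h1.hasDerivWithinAt.congr (fun x hx => hfi x hx) (hfi r hr)
  · have h1 := hasDerivAt_mul_average hg hr n
    rw [← hvi r hr.le] at h1
    refine h1.congr_of_eventuallyEq ?_
    filter_upwards [lt_mem_nhds hr] with x hx using hvi x (le_of_lt hx)
  · have h1 := (hasDerivAt_mul_average_zero hg n).hasDerivWithinAt (s := Ici 0)
    simp only [hf0, hv0, abs_zero, sub_zero] at h1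
    exact h1.congr (fun x hx => hvi x hx) (hvi 0 le_rfl)

lemma abs_clamp_sub_le (M x y : ℝ) :
    |max (-M) (min x M) - max (-M) (min y M)| ≤ |x - y| := by
  rw [max_comm (-M), max_comm (-M)]
  exact (abs_max_sub_max_le_abs _ _ _).trans (by
    simpa using abs_min_sub_min_le_max x M y M)

/-- Global existence. The nonlinearity is truncated at a height growing with `r`; the energy
`f² / 2 + |v| ^ (m + 1) / (m + 1)` keeps the solution below that height, so the truncation
is never active. -/
theorem exists_isFlow (n : ℕ) {m : ℝ} (hm : 1 < m) (a : ℝ) : ∃ f v, IsFlow n m a f v := by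
  set B : ℝ → ℝ := fun r => (a ^ 2 / 2 + 1) * Real.exp ((m + 2) * r) with hB
  have hBpos : ∀ r, 0 < B r := fun r => by positivity
  have hBc : Continuous B := by fun_prop
  set M : ℝ → ℝ := fun r => ((m + 1) * B r) ^ (1 / (m + 1)) with hM
  have hMpos : ∀ r, 0 < M r := fun r => Real.rpow_pos_of_pos (mul_pos (by linarith) (hBpos r)) _
  have hMc : Continuous M :=
    (by fun_prop : Continuous fun r => (m + 1) * B r).rpow_const
      fun r => Or.inl (mul_pos (by linarith) (hBpos r)).ne'
  set ψ : ℝ → ℝ → ℝ := fun s x => sPow m (max (-M s) (min x (M s))) with hψdef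
  have hψ : Continuous (Function.uncurry ψ) := by
    simp only [hψdef, Function.uncurry_def]
    exact (continuous_sPow hm).comp (by fun_prop)
  have hψeq : ∀ s x, |x| ≤ M s → ψ s x = sPow m x := fun s x hx => by
    rw [abs_le] at hx
    simp only [hψdef]
    rw [min_eq_left hx.2, max_eq_right hx.1]
  have hcl : ∀ s x, |max (-M s) (min x (M s))| ≤ M s := fun s x => by
    rw [abs_le]
    exact ⟨le_max_left _ _, max_le (by linarith [hMpos s]) (min_le_right _ _)⟩
  obtain ⟨f, v, hf, hv, hfi, hvi⟩ := exists_volterra_solution n a hψ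
    (L := fun s => 2 + 2 * (m * M s ^ (m - 1)))
    (fun s => by rw [hψeq s 0 (by simpa using (hMpos s).le), sPow_zero])
    (continuous_const.add (continuous_const.mul (continuous_const.mul
      (hMc.rpow_const fun r => Or.inl (hMpos r).ne'))))
    (fun s => by
      have := Real.rpow_pos_of_pos (hMpos s) (m - 1)
      have : 0 < m * M s ^ (m - 1) := by positivity
      linarith)
    (fun s x y => by
      have h0 := Real.rpow_pos_of_pos (hMpos s) (m - 1)
      have h1 : 0 < m * M s ^ (m - 1) := by positivity
      refine (abs_sPow_sub_le hm (hcl s x) (hcl s y)).trans ?_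
      have := mul_le_mul_of_nonneg_left (abs_clamp_sub_le (M s) x y)
        (by linarith : 0 ≤ 2 * (m * M s ^ (m - 1)))
      nlinarith [abs_nonneg (x - y)])
  obtain ⟨hf0, hv0, hfd, hvd, hvd0⟩ := hasDeriv_of_volterra hψ hf hv hfi hvi
  have hE : ∀ r, 0 ≤ r → f r ^ 2 / 2 + |v r| ^ (m + 1) / (m + 1) ≤ B r := by
    intro b hb
    set w : ℝ → ℝ := fun r => if r = 0 then a / (n + 1) else f r - |v r| - n / r * v r with hw
    have hwd : ∀ r, 0 ≤ r → HasDerivWithinAt v (w r) (Ici r) r := by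
      intro r hr
      rcases hr.eq_or_lt with rfl | hr
      · simpa [hw] using hvd0
      · simpa [hw, hr.ne'] using (hvd r hr).hasDerivWithinAt
    refine image_le_of_deriv_right_lt_deriv_boundary'
      (f := fun r => f r ^ 2 / 2 + |v r| ^ (m + 1) / (m + 1))
      (f' := fun r => f r * (-ψ r (v r)) + sPow m (v r) * w r)
      (B := B) (B' := fun r => (m + 2) * B r) (a := 0) (b := b)
      ?_ ?_ ?_ hBc.continuousOn ?_ ?_ (right_mem_Icc.2 hb)
    · exact ((hf.pow 2).div_const 2).continuousOn.add
        (((hv.abs).rpow_const fun x => Or.inr (by linarith)).div_const _).continuousOn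
    · intro x hx
      have h1 := ((hfd x hx.1).mono (Ici_subset_Ici.2 hx.1)).pow 2 |>.div_const 2
      have h2 := (hasDerivAt_abs_rpow_div hm (v x)).comp_hasDerivWithinAt x (hwd x hx.1)
      refine (h1.add h2).congr_deriv ?_
      simp only [Nat.cast_ofNat]
      ring
    · simp only [hf0, hv0, abs_zero, hB, mul_zero, Real.exp_zero, mul_one]
      rw [Real.zero_rpow (by linarith)]
      simp
    · intro x _
      have h : HasDerivAt (fun r => (m + 2) * r) (m + 2) x := by
        simpa using (hasDerivAt_id x).const_mul (m + 2)
      exact ((h.exp.const_mul (a ^ 2 / 2 + 1)).congr_deriv (by simp only [hB]; ring)).hasDerivWithinAt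
    · intro x hx hEB
      have hx0 : 0 < x := by
        rcases hx.1.eq_or_lt with rfl | h
        · simp only [hf0, hv0, abs_zero, hB, mul_zero, Real.exp_zero, mul_one] at hEB
          rw [Real.zero_rpow (by linarith)] at hEB
          simp at hEB
        · exact h
      rw [hψeq x _ (abs_le_of_energy_le hm hEB.le)]
      simp only [hw, hx0.ne', if_false]
      have e1 := energy_deriv_le m (f x) (v x) hm (by positivity : 0 ≤ (n : ℝ) / x)
      have e2 := abs_rpow_le_of_energy_le hm hEB.le
      linarith [hBpos x]
  refine ⟨f, v, hf0, hv0, fun r hr => ?_, hvd, hvd0⟩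
  rw [← hψeq r _ (abs_le_of_energy_le hm (hE r hr))]
  exact hfd r hr

namespace IsFlow

variable {n : ℕ} {m a b : ℝ} {f v g w : ℝ → ℝ}

lemma continuousOn_f (h : IsFlow n m a f v) : ContinuousOn f (Ici 0) :=
  fun r hr => (h.deriv_f r hr).continuousWithinAt

lemma continuousOn_v (h : IsFlow n m a f v) : ContinuousOn v (Ici 0) := fun r hr => by
  rcases (mem_Ici.1 hr).eq_or_lt with rfl | hr
  · exact h.deriv_v_zero.continuousWithinAt
  · exact (h.deriv_v r hr).continuousAt.continuousWithinAt

lemma hasDerivAt_f (h : IsFlow n m a f v) {r : ℝ} (hr : 0 < r) :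
    HasDerivAt f (-sPow m (v r)) r := (h.deriv_f r hr.le).hasDerivAt (Ici_mem_nhds hr)

lemma tendsto_v_div (h : IsFlow n m a f v) :
    Tendsto (fun r => v r / r) (𝓝[>] 0) (𝓝 (a / (n + 1))) := by
  have := (hasDerivWithinAt_iff_tendsto_slope' (by simp)).1
    (h.deriv_v_zero.mono Ioi_subset_Ici_self)
  refine this.congr fun x => ?_
  simp [slope_def_field, h.v_zero]

end IsFlow

/-! ### Monotonicity from derivatives on half-lines and intervals -/

lemma antitoneOn_of_hasDerivAt {F F' : ℝ → ℝ} {s : Set ℝ} (hs : Convex ℝ s)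
    (hF : ContinuousOn F s) (hd : ∀ x ∈ interior s, HasDerivAt F (F' x) x)
    (h : ∀ x ∈ interior s, F' x ≤ 0) : AntitoneOn F s :=
  antitoneOn_of_deriv_nonpos hs hF (fun x hx => (hd x hx).differentiableAt.differentiableWithinAt)
    fun x hx => by rw [(hd x hx).deriv]; exact h x hx

lemma monotoneOn_of_hasDerivAt {F F' : ℝ → ℝ} {s : Set ℝ} (hs : Convex ℝ s)
    (hF : ContinuousOn F s) (hd : ∀ x ∈ interior s, HasDerivAt F (F' x) x)
    (h : ∀ x ∈ interior s, 0 ≤ F' x) : MonotoneOn F s :=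
  monotoneOn_of_deriv_nonneg hs hF (fun x hx => (hd x hx).differentiableAt.differentiableWithinAt)
    fun x hx => by rw [(hd x hx).deriv]; exact h x hx

lemma strictAntiOn_of_hasDerivAt {F F' : ℝ → ℝ} {s : Set ℝ} (hs : Convex ℝ s)
    (hF : ContinuousOn F s) (hd : ∀ x ∈ interior s, HasDerivAt F (F' x) x)
    (h : ∀ x ∈ interior s, F' x < 0) : StrictAntiOn F s :=
  strictAntiOn_of_deriv_neg hs hF fun x hx => by rw [(hd x hx).deriv]; exact h x hx

lemma strictMonoOn_of_hasDerivAt {F F' : ℝ → ℝ} {s : Set ℝ} (hs : Convex ℝ s)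
    (hF : ContinuousOn F s) (hd : ∀ x ∈ interior s, HasDerivAt F (F' x) x)
    (h : ∀ x ∈ interior s, 0 < F' x) : StrictMonoOn F s :=
  strictMonoOn_of_deriv_pos hs hF fun x hx => by rw [(hd x hx).deriv]; exact h x hx

/-! ### Uniqueness and continuous dependence -/

namespace IsFlow

variable {n : ℕ} {m a b : ℝ} {f v g w : ℝ → ℝ}

lemma sq_add_sq_le (hm : 1 < m) (h : IsFlow n m a f v) (k : IsFlow n m b g w) {T M : ℝ}
    (hv : ∀ r ∈ Icc 0 T, |v r| ≤ M) (hw : ∀ r ∈ Icc 0 T, |w r| ≤ M) {r : ℝ} (hr : r ∈ Icc 0 T) :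
    (f r - g r) ^ 2 + (v r - w r) ^ 2
      ≤ (a - b) ^ 2 * Real.exp ((2 * (m * M ^ (m - 1)) + 3) * r) := by
  set C := 2 * (m * M ^ (m - 1)) with hC
  have hM : 0 ≤ M := (abs_nonneg _).trans (hv r hr)
  have hC0 : 0 ≤ C := by
    have := Real.rpow_nonneg hM (m - 1)
    positivity
  have hsub : Icc 0 T ⊆ Ici (0 : ℝ) := fun x hx => hx.1
  have hanti : AntitoneOn (fun r => ((f r - g r) ^ 2 + (v r - w r) ^ 2) * Real.exp (-(C + 3) * r))
      (Icc 0 T) := by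
    refine antitoneOn_of_hasDerivAt (convex_Icc 0 T) (F' := fun r =>
      (2 * (f r - g r) * (-sPow m (v r) - -sPow m (w r)) + 2 * (v r - w r) *
        ((f r - |v r| - n / r * v r) - (g r - |w r| - n / r * w r))
        - (C + 3) * ((f r - g r) ^ 2 + (v r - w r) ^ 2)) * Real.exp (-(C + 3) * r)) ?_ ?_ ?_
    · have h1 := h.continuousOn_f.mono hsub
      have h2 := h.continuousOn_v.mono hsub
      have h3 := k.continuousOn_f.mono hsub
      have h4 := k.continuousOn_v.mono hsub
      fun_prop
    · intro x hx
      rw [interior_Icc] at hx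
      have e : HasDerivAt (fun r => Real.exp (-(C + 3) * r))
          (Real.exp (-(C + 3) * x) * -(C + 3)) x := by
        simpa using ((hasDerivAt_id x).const_mul (-(C + 3))).exp
      refine (((((h.hasDerivAt_f hx.1).sub (k.hasDerivAt_f hx.1)).pow 2).add
        (((h.deriv_v x hx.1).sub (k.deriv_v x hx.1)).pow 2)).mul e).congr_deriv ?_
      simp only [Pi.sub_apply, Pi.add_apply, Pi.pow_apply, Nat.cast_ofNat]
      ring
    · intro x hx
      rw [interior_Icc] at hx
      refine mul_nonpos_of_nonpos_of_nonneg ?_ (Real.exp_pos _).le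
      have hx' : x ∈ Icc 0 T := ⟨hx.1.le, hx.2.le⟩
      have hL := abs_sPow_sub_le hm (hv x hx') (hw x hx')
      rw [← hC] at hL
      have h1 : -((f x - g x) * (sPow m (v x) - sPow m (w x)))
          ≤ |f x - g x| * (C * |v x - w x|) := by
        refine (neg_le_abs _).trans ?_
        rw [abs_mul]
        exact mul_le_mul_of_nonneg_left hL (abs_nonneg _)
      have h2 : (v x - w x) * (f x - g x) ≤ |f x - g x| * |v x - w x| := by
        rw [mul_comm, ← abs_mul]; exact le_abs_self _
      have h3 : -((v x - w x) * (|v x| - |w x|)) ≤ |v x - w x| ^ 2 := by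
        refine (neg_le_abs _).trans ?_
        rw [abs_mul, sq]
        exact mul_le_mul_of_nonneg_left (abs_abs_sub_abs_le _ _) (abs_nonneg _)
      have h4 : 0 ≤ (n : ℝ) / x * (v x - w x) ^ 2 := by
        have := hx.1
        positivity
      have h5 : C * (2 * (|f x - g x| * |v x - w x|)) ≤ C * (|f x - g x| ^ 2 + |v x - w x| ^ 2) :=
        mul_le_mul_of_nonneg_left (by nlinarith [sq_nonneg (|f x - g x| - |v x - w x|)]) hC0
      have h6 := sq_nonneg (|f x - g x| - |v x - w x|)
      have h7 := sq_nonneg (f x - g x)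
      have h8 := sq_abs (f x - g x)
      have h9 := sq_abs (v x - w x)
      have : 2 * (f x - g x) * (-sPow m (v x) - -sPow m (w x)) + 2 * (v x - w x) *
          ((f x - |v x| - n / x * v x) - (g x - |w x| - n / x * w x))
          = 2 * -((f x - g x) * (sPow m (v x) - sPow m (w x))) + 2 * ((v x - w x) * (f x - g x))
            + 2 * -((v x - w x) * (|v x| - |w x|)) - 2 * (n / x * (v x - w x) ^ 2) := by ring
      rw [this]
      rw [h8, h9] at h5
      rw [h9] at h3
      linarith
  have := hanti (left_mem_Icc.2 (hr.1.trans hr.2)) hr hr.1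
  simp only [h.f_zero, k.f_zero, h.v_zero, k.v_zero, mul_zero, Real.exp_zero] at this
  have e : Real.exp (-(C + 3) * r) * Real.exp ((C + 3) * r) = 1 := by
    rw [← Real.exp_add, ← add_mul]; simp
  have := mul_le_mul_of_nonneg_right this (Real.exp_pos ((C + 3) * r)).le
  rw [mul_assoc, e] at this
  linarith

theorem eqOn (hm : 1 < m) (h : IsFlow n m a f v) (k : IsFlow n m a g w) :
    EqOn f g (Ici 0) := by
  intro r hr
  obtain ⟨M₁, h₁⟩ := isCompact_Icc.exists_bound_of_continuousOn
    (h.continuousOn_v.mono (fun x hx => hx.1 : Icc 0 r ⊆ Ici 0))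
  obtain ⟨M₂, h₂⟩ := isCompact_Icc.exists_bound_of_continuousOn
    (k.continuousOn_v.mono (fun x hx => hx.1 : Icc 0 r ⊆ Ici 0))
  have := h.sq_add_sq_le hm k (M := max M₁ M₂) (fun x hx => (h₁ x hx).trans (le_max_left _ _))
    (fun x hx => (h₂ x hx).trans (le_max_right _ _)) (right_mem_Icc.2 hr)
  simp only [sub_self, ne_eq, OfNat.ofNat_ne_zero, not_false_eq_true, zero_pow, zero_mul] at this
  nlinarith [sq_nonneg (f r - g r), sq_nonneg (v r - w r)]

lemma energy_le (hm : 1 < m) (h : IsFlow n m a f v) {r : ℝ} (hr : 0 ≤ r) :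
    f r ^ 2 / 2 + |v r| ^ (m + 1) / (m + 1) ≤ a ^ 2 / 2 * Real.exp ((m + 1) * r) := by
  have hanti : AntitoneOn (fun r => (f r ^ 2 / 2 + |v r| ^ (m + 1) / (m + 1))
      * Real.exp (-(m + 1) * r)) (Ici 0) := by
    refine antitoneOn_of_hasDerivAt (convex_Ici 0) (F' := fun r =>
      (f r * -sPow m (v r) + sPow m (v r) * (f r - |v r| - n / r * v r)
        - (m + 1) * (f r ^ 2 / 2 + |v r| ^ (m + 1) / (m + 1))) * Real.exp (-(m + 1) * r)) ?_ ?_ ?_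
    · have h1 := h.continuousOn_f
      have h2 := (h.continuousOn_v.abs.rpow_const (p := m + 1) fun x _ => Or.inr (by linarith))
      fun_prop
    · intro x hx
      rw [interior_Ici] at hx
      have e : HasDerivAt (fun r => Real.exp (-(m + 1) * r))
          (Real.exp (-(m + 1) * x) * -(m + 1)) x := by
        simpa using ((hasDerivAt_id x).const_mul (-(m + 1))).exp
      have h2 := (hasDerivAt_abs_rpow_div hm (v x)).comp x (h.deriv_v x hx)
      refine (((((h.hasDerivAt_f hx).pow 2).div_const 2).add h2).mul e).congr_deriv ?_
      simp only [Pi.add_apply, Pi.pow_apply, Function.comp, Nat.cast_ofNat]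
      ring
    · intro x hx
      rw [interior_Ici] at hx
      have hx : 0 < x := hx
      refine mul_nonpos_of_nonpos_of_nonneg ?_ (Real.exp_pos _).le
      have e1 := energy_deriv_le m (f x) (v x) hm (by positivity : 0 ≤ (n : ℝ) / x)
      have e2 : (m + 1) * (f x ^ 2 / 2 + |v x| ^ (m + 1) / (m + 1))
          = (m + 1) * f x ^ 2 / 2 + |v x| ^ (m + 1) := by
        have : m + 1 ≠ 0 := by linarith
        field_simp
      have e3 : 0 ≤ (m + 1) * f x ^ 2 / 2 := by positivity
      linarith
  have := hanti (mem_Ici.2 le_rfl) hr hr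
  simp only [h.f_zero, h.v_zero, mul_zero, Real.exp_zero, abs_zero] at this
  rw [Real.zero_rpow (by linarith), zero_div] at this
  have e : Real.exp (-(m + 1) * r) * Real.exp ((m + 1) * r) = 1 := by
    rw [← Real.exp_add, ← add_mul]; simp
  have := mul_le_mul_of_nonneg_right this (Real.exp_pos ((m + 1) * r)).le
  rw [mul_assoc, e] at this
  linarith

lemma abs_v_le (hm : 1 < m) (h : IsFlow n m a f v) {r T A : ℝ} (hr : r ∈ Icc 0 T)
    (hA : |a| ≤ A) :
    |v r| ≤ ((m + 1) * (A ^ 2 / 2 * Real.exp ((m + 1) * T))) ^ (1 / (m + 1)) := by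
  refine abs_le_of_energy_le hm ((h.energy_le hm hr.1).trans ?_)
  rw [← sq_abs a]
  have := hr.2
  gcongr

/-- Continuous dependence on the initial value, uniformly on compact intervals. -/
theorem eventually_close {F W : ℝ → ℝ → ℝ} (hm : 1 < m)
    (hF : ∀ a, IsFlow n m a (F a) (W a)) (a : ℝ) (T : ℝ) {ε : ℝ} (hε : 0 < ε) :
    ∀ᶠ b in 𝓝 a, ∀ r ∈ Icc 0 T, |F b r - F a r| < ε ∧ |W b r - W a r| < ε := by
  set M := ((m + 1) * ((|a| + 1) ^ 2 / 2 * Real.exp ((m + 1) * T))) ^ (1 / (m + 1)) with hM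
  set K := 2 * (m * M ^ (m - 1)) + 3 with hK
  have hM0 : 0 ≤ M := by positivity
  have hK0 : 0 ≤ K := by
    have := Real.rpow_nonneg hM0 (m - 1)
    positivity
  have h1 : Tendsto (fun b => (b - a) ^ 2 * Real.exp (K * T)) (𝓝 a) (𝓝 0) := by
    have : Continuous fun b => (b - a) ^ 2 * Real.exp (K * T) := by fun_prop
    simpa using this.tendsto a
  have h2 : ∀ᶠ b in 𝓝 a, |b| < |a| + 1 :=
    continuous_abs.continuousAt.eventually_lt continuousAt_const (by simp)
  filter_upwards [h1.eventually_lt_const (by positivity : 0 < ε ^ 2), h2] with b hb1 hb2 r hr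
  have h3 := (hF b).sq_add_sq_le hm (hF a) (fun x hx => (hF b).abs_v_le hm hx hb2.le)
    (fun x hx => (hF a).abs_v_le hm hx (by linarith)) hr
  have h4 : (b - a) ^ 2 * Real.exp (K * r) ≤ (b - a) ^ 2 * Real.exp (K * T) := by
    have := hr.2
    gcongr
  constructor
  · refine abs_lt_of_sq_lt_sq ?_ hε.le
    nlinarith [sq_nonneg (W b r - W a r)]
  · refine abs_lt_of_sq_lt_sq ?_ hε.le
    nlinarith [sq_nonneg (F b r - F a r)]

end IsFlow

/-! ### Equivalence with the profile equation -/

lemma abs_sPow (q x : ℝ) (hq : 0 < q) : |sPow q x| = |x| ^ q := by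
  rw [sPow, abs_mul, abs_of_nonneg (Real.rpow_nonneg (abs_nonneg x) _)]
  rcases eq_or_ne x 0 with rfl | hx
  · simp [Real.zero_rpow hq.ne']
  · rw [← Real.rpow_add_one (abs_ne_zero.2 hx)]; simp

lemma sPow_sPow_of_mul_eq_one {q k : ℝ} (hq : 0 < q) (hk : k * q = 1) (x : ℝ) :
    sPow k (sPow q x) = x := by
  rcases eq_or_ne x 0 with rfl | hx
  · simp [sPow_zero]
  · rw [sPow, abs_sPow _ _ hq, sPow, ← Real.rpow_mul (abs_nonneg x), ← mul_assoc,
      ← Real.rpow_add (abs_pos.2 hx)]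
    rw [show q * (k - 1) + (q - 1) = 0 by linarith]
    simp

lemma sPow_neg (q x : ℝ) : sPow q (-x) = -sPow q x := by simp [sPow]

lemma flux_eq (p : ℝ) (f : ℝ → ℝ) (r : ℝ) : flux p f r = sPow (p - 1) (radialDeriv f r) := by
  rw [flux, sPow, show p - 1 - 1 = p - 2 by ring]

theorem IsFlow.isProfile {n : ℕ} {p a : ℝ} {f v : ℝ → ℝ} (hp : 1 < p) (hp2 : p < 2)
    (h : IsFlow n (1 / (p - 1)) a f v) : IsProfile (n + 1) p a f := by
  have hd : ∀ r, 0 ≤ r → radialDeriv f r = -sPow (1 / (p - 1)) (v r) := fun r hr =>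
    (h.deriv_f r hr).derivWithin (uniqueDiffOn_Ici 0 r hr)
  have hp1 : 0 < p - 1 := by linarith
  have hfl : EqOn (flux p f) (fun r => -v r) (Ici 0) := fun r hr => by
    rw [flux_eq, hd r hr, sPow_neg, sPow_sPow_of_mul_eq_one (by positivity)
      (mul_one_div_cancel hp1.ne')]
  have hdv : ∀ r, 0 < r → radialDeriv (flux p f) r = -(f r - |v r| - n / r * v r) := fun r hr => by
    rw [radialDeriv, derivWithin_congr hfl (hfl hr.le)]
    exact ((h.deriv_v r hr).neg.hasDerivWithinAt).derivWithin (uniqueDiffOn_Ici 0 r hr.le)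
  have hdv0 : derivWithin v (Ici 0) 0 = a / (n + 1) :=
    h.deriv_v_zero.derivWithin (uniqueDiffOn_Ici 0 0 (mem_Ici.2 le_rfl))
  have hcv := h.continuousOn_v
  have hcf := h.continuousOn_f
  refine ⟨?_, ?_, fun r hr => ?_, h.f_zero, ?_⟩
  · rw [contDiffOn_one_iff_derivWithin (uniqueDiffOn_Ici 0)]
    refine ⟨fun r hr => (h.deriv_f r hr).differentiableWithinAt, ?_⟩
    have : ContinuousOn (fun r => -sPow (1 / (p - 1)) (v r)) (Ici 0) := by
      exact ((continuous_sPow (by rw [lt_div_iff₀ hp1]; linarith)).comp_continuousOn hcv).neg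
    exact this.congr fun r hr => hd r hr
  · refine ContDiffOn.congr ?_ hfl
    refine ContDiffOn.neg ?_
    rw [contDiffOn_one_iff_derivWithin (uniqueDiffOn_Ici 0)]
    refine ⟨fun r hr => ?_, fun r hr => ?_⟩
    · rcases (mem_Ici.1 hr).eq_or_lt with rfl | hr
      · exact h.deriv_v_zero.differentiableWithinAt
      · exact (h.deriv_v r hr).differentiableAt.differentiableWithinAt
    · have hE : ∀ x, 0 < x → derivWithin v (Ici 0) x = f x - |v x| - n / x * v x := fun x hx =>
        (h.deriv_v x hx).hasDerivWithinAt.derivWithin (uniqueDiffOn_Ici 0 x hx.le)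
      rcases (mem_Ici.1 hr).eq_or_lt with rfl | hr
      · rw [← Ioi_insert, continuousWithinAt_insert_self, ContinuousWithinAt]
        rw [Ioi_insert, hdv0]
        have h2 : Tendsto (fun x => f x - |v x|) (𝓝[>] 0) (𝓝 a) := by
          have : ContinuousWithinAt (fun x => f x - |v x|) (Ici 0) 0 :=
            (hcf.sub hcv.abs) 0 (mem_Ici.2 le_rfl)
          have := this.mono Ioi_subset_Ici_self
          simpa [ContinuousWithinAt, h.f_zero, h.v_zero] using this
        have h3 := h2.sub (h.tendsto_v_div.const_mul (n : ℝ))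
        have h4 : a - n * (a / (n + 1)) = a / (n + 1) := by field_simp; ring
        rw [h4] at h3
        refine h3.congr' ?_
        filter_upwards [self_mem_nhdsWithin] with x hx
        rw [hE x hx]; ring
      · have : ContinuousAt (fun x => f x - |v x| - n / x * v x) r := by
          have h1 := hcf.continuousAt (Ici_mem_nhds hr)
          have h2 := hcv.continuousAt (Ici_mem_nhds hr)
          have := hr.ne'
          fun_prop (disch := assumption)
        refine (this.congr ?_).continuousWithinAt
        filter_upwards [lt_mem_nhds hr] with x hx using (hE x hx).symm
  · rw [hdv r hr, hfl hr.le, hd r hr.le, abs_neg, abs_sPow _ _ (by positivity),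
      ← Real.rpow_mul (abs_nonneg _), one_div_mul_cancel hp1.ne', Real.rpow_one]
    push_cast; ring
  · rw [hd 0 le_rfl, h.v_zero, sPow_zero, neg_zero]

theorem IsProfile.isFlow {n : ℕ} {p a : ℝ} {f : ℝ → ℝ} (hp : 1 < p)
    (h : IsProfile (n + 1) p a f) : IsFlow n (1 / (p - 1)) a f (fun r => -flux p f r) := by
  have hp1 : 0 < p - 1 := by linarith
  have hpm : 0 < 1 / (p - 1) := by positivity
  have hcF := (contDiffOn_one_iff_derivWithin (uniqueDiffOn_Ici 0)).1 h.contDiffOn_flux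
  have hcf := (contDiffOn_one_iff_derivWithin (uniqueDiffOn_Ici 0)).1 h.contDiffOn
  have hfl0 : flux p f 0 = 0 := by rw [flux_eq, h.init_deriv, sPow_zero]
  have hode : ∀ r, 0 < r → derivWithin (flux p f) (Ici 0) r
      = -(f r - |flux p f r| - n / r * (-flux p f r)) := by
    intro r hr
    have := h.ode r hr
    rw [radialDeriv] at this
    rw [flux_eq, abs_sPow _ _ hp1, ← flux_eq]
    push_cast at this
    linear_combination this
  refine ⟨h.init, by simp [hfl0], fun r hr => ?_, fun r hr => ?_, ?_⟩
  · rw [sPow_neg, flux_eq, sPow_sPow_of_mul_eq_one hp1 (one_div_mul_cancel hp1.ne'), neg_neg]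
    exact (hcf.1 r hr).hasDerivWithinAt
  · have := ((hcF.1 r hr.le).hasDerivWithinAt.hasDerivAt (Ici_mem_nhds hr)).neg
    rw [hode r hr] at this
    refine this.congr_deriv ?_
    simp
  · -- the value of the flux derivative at `0` is forced by letting `r → 0` in the equation
    set c := derivWithin (flux p f) (Ici 0) 0 with hc
    have h0 : HasDerivWithinAt (flux p f) c (Ici 0) 0 := (hcF.1 0 (mem_Ici.2 le_rfl)).hasDerivWithinAt
    have h1 : Tendsto (fun x => flux p f x / x) (𝓝[>] 0) (𝓝 c) := by
      have := (hasDerivWithinAt_iff_tendsto_slope' (by simp)).1 (h0.mono Ioi_subset_Ici_self)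
      refine this.congr fun x => ?_
      simp [slope_def_field, hfl0]
    have h2 : Tendsto (fun x => f x - |flux p f x|) (𝓝[>] 0) (𝓝 a) := by
      have : ContinuousWithinAt (fun x => f x - |flux p f x|) (Ici 0) 0 :=
        (h.contDiffOn.continuousOn.sub h.contDiffOn_flux.continuousOn.abs) 0 (mem_Ici.2 le_rfl)
      have := this.mono Ioi_subset_Ici_self
      simpa [ContinuousWithinAt, h.init, hfl0] using this
    have h3 : Tendsto (derivWithin (flux p f) (Ici 0)) (𝓝[>] 0) (𝓝 c) :=
      (hcF.2 0 (mem_Ici.2 le_rfl)).mono Ioi_subset_Ici_self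
    have h4 : Tendsto (derivWithin (flux p f) (Ici 0)) (𝓝[>] 0) (𝓝 (-(a + n * c))) := by
      refine ((h2.add (h1.const_mul (n : ℝ))).neg).congr' ?_
      filter_upwards [self_mem_nhdsWithin] with x hx
      rw [hode x hx]; ring
    have h5 := tendsto_nhds_unique h3 h4
    have h6 : -c = a / (n + 1) := by
      rw [eq_div_iff (by positivity)]; linarith
    rw [← h6]
    exact h0.neg

/-! ### The weight -/

/-- The integrating factor `rⁿ eʳ` of the equation for `v`. -/
noncomputable def rho (n : ℕ) (r : ℝ) : ℝ := r ^ n * Real.exp r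

lemma rho_pos (n : ℕ) {r : ℝ} (hr : 0 < r) : 0 < rho n r := by unfold rho; positivity

lemma rho_nonneg (n : ℕ) {r : ℝ} (hr : 0 ≤ r) : 0 ≤ rho n r := by unfold rho; positivity

lemma continuous_rho (n : ℕ) : Continuous (rho n) := by unfold rho; fun_prop

lemma hasDerivAt_rho (n : ℕ) {r : ℝ} (hr : 0 < r) :
    HasDerivAt (rho n) (rho n r * (1 + n / r)) r := by
  refine ((hasDerivAt_pow n r).mul (Real.hasDerivAt_exp r)).congr_deriv ?_
  rcases n with _ | n
  · simp [rho]
  · simp only [Nat.add_sub_cancel, rho]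
    field_simp
    ring

lemma rho_mono (n : ℕ) {r s : ℝ} (hr : 0 ≤ r) (hrs : r ≤ s) : rho n r ≤ rho n s := by
  have := pow_le_pow_left₀ hr hrs n
  have := pow_nonneg (hr.trans hrs) n
  unfold rho; gcongr

lemma exp_le_rho (n : ℕ) {r : ℝ} (hr : 1 ≤ r) : Real.exp r ≤ rho n r :=
  le_mul_of_one_le_left (Real.exp_pos r).le (one_le_pow₀ hr)

lemma pow_le_rho (n : ℕ) {r : ℝ} (hr : 0 ≤ r) : r ^ n ≤ rho n r :=
  le_mul_of_one_le_right (pow_nonneg hr n) (Real.one_le_exp hr)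

/-- Solutions of `u' ≤ δ - k u` are eventually below any level above `δ / k`. -/
lemma eventually_le_of_deriv_le {u u' : ℝ → ℝ} {k δ r₀ ε : ℝ} (hk : 0 < k)
    (hu : ∀ r, r₀ ≤ r → HasDerivAt u (u' r) r) (h : ∀ r, r₀ ≤ r → u' r ≤ δ - k * u r)
    (hε : 0 < ε) : ∀ᶠ r in atTop, u r ≤ δ / k + ε := by
  have hanti : AntitoneOn (fun r => (u r - δ / k) * Real.exp (k * r)) (Ici r₀) := by
    have hd : ∀ r, r₀ ≤ r → HasDerivAt (fun r => (u r - δ / k) * Real.exp (k * r))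
        ((u' r - (δ - k * u r)) * Real.exp (k * r)) r := fun r hr => by
      have e : HasDerivAt (fun r => Real.exp (k * r)) (Real.exp (k * r) * k) r := by
        simpa using ((hasDerivAt_id r).const_mul k).exp
      refine (((hu r hr).sub_const (δ / k)).mul e).congr_deriv ?_
      field_simp
      ring
    refine antitoneOn_of_hasDerivAt (convex_Ici r₀)
      (fun r hr => (hd r hr).continuousAt.continuousWithinAt)
      (fun r hr => hd r (interior_subset hr)) fun r hr => ?_
    exact mul_nonpos_of_nonpos_of_nonneg (by linarith [h r (interior_subset hr)])
      (Real.exp_pos _).le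
  have hlim : Tendsto (fun r => (u r₀ - δ / k) * Real.exp (k * r₀) * Real.exp (-(k * r))) atTop
      (𝓝 ((u r₀ - δ / k) * Real.exp (k * r₀) * 0)) :=
    (Real.tendsto_exp_neg_atTop_nhds_zero.comp (tendsto_id.const_mul_atTop hk)).const_mul _
  rw [mul_zero] at hlim
  filter_upwards [hlim.eventually_lt_const hε, eventually_ge_atTop r₀] with r h1 h2
  have h3 := mul_le_mul_of_nonneg_right (hanti self_mem_Ici h2 h2) (Real.exp_pos (-(k * r))).le
  have h4 : Real.exp (k * r) * Real.exp (-(k * r)) = 1 := by rw [← Real.exp_add]; simp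
  simp only [mul_assoc, h4] at h3 h1
  linarith

namespace IsFlow

variable {n : ℕ} {m a b : ℝ} {f v g w : ℝ → ℝ}

/-! ### The phase where `f` is positive -/

lemma v_nonneg (h : IsFlow n m a f v) (ha : 0 < a) {R : ℝ}
    (hpos : ∀ s, 0 ≤ s → s < R → 0 < f s) {r : ℝ} (hr : 0 ≤ r) (hrR : r ≤ R) : 0 ≤ v r := by
  set d : ℝ → ℝ := fun r => if r = 0 then a / (n + 1) else f r - |v r| - n / r * v r with hd
  have key := image_le_of_deriv_right_lt_deriv_boundary' (f := -v)
    (f' := fun r => -d r) (B := fun _ => 0) (B' := fun _ => 0) (a := 0) (b := r)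
    (h.continuousOn_v.neg.mono fun x hx => hx.1)
    (fun x hx => by
      rcases hx.1.eq_or_lt with rfl | hx0
      · simpa [hd] using h.deriv_v_zero.neg
      · simpa only [hd, hx0.ne', if_false] using (h.deriv_v x hx0).neg.hasDerivWithinAt)
    (by simp [h.v_zero]) continuousOn_const
    (fun x _ => hasDerivWithinAt_const _ _ _)
    (fun x hx hvx => by
      have hvx : v x = 0 := by simpa using hvx
      rcases hx.1.eq_or_lt with rfl | hx0
      · simp only [hd, if_true, Left.neg_neg_iff]; positivity
      · simpa [hd, hx0.ne', hvx] using hpos x hx.1 (hx.2.trans_le hrR))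
    (right_mem_Icc.2 hr)
  simpa using key

lemma hasDerivAt_rho_mul (h : IsFlow n m a f v) {r : ℝ} (hr : 0 < r) (hv : 0 ≤ v r) :
    HasDerivAt (fun r => rho n r * v r) (rho n r * f r) r := by
  refine ((hasDerivAt_rho n hr).mul (h.deriv_v r hr)).congr_deriv ?_
  rw [abs_of_nonneg hv]
  ring

lemma hasDerivAt_f_of_nonneg (hm : 1 < m) (h : IsFlow n m a f v) {r : ℝ} (hr : 0 < r)
    (hv : 0 ≤ v r) : HasDerivAt f (-(v r ^ m)) r := by
  rw [← sPow_of_nonneg hm hv]; exact h.hasDerivAt_f hr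

lemma strictMonoOn_rho_mul (h : IsFlow n m a f v) (ha : 0 < a) {R : ℝ}
    (hpos : ∀ s, 0 ≤ s → s < R → 0 < f s) : StrictMonoOn (fun r => rho n r * v r) (Icc 0 R) := by
  refine strictMonoOn_of_hasDerivAt (F' := fun r => rho n r * f r) (convex_Icc 0 R)
    ((continuous_rho n).continuousOn.mul (h.continuousOn_v.mono fun x hx => hx.1)) ?_ ?_ <;>
  · intro x hx
    rw [interior_Icc] at hx
    first
    | exact h.hasDerivAt_rho_mul hx.1 (h.v_nonneg ha hpos hx.1.le hx.2.le)
    | exact mul_pos (rho_pos n hx.1) (hpos x hx.1.le hx.2)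

lemma v_pos (h : IsFlow n m a f v) (ha : 0 < a) {R : ℝ}
    (hpos : ∀ s, 0 ≤ s → s < R → 0 < f s) {r : ℝ} (hr : 0 < r) (hrR : r ≤ R) : 0 < v r := by
  have := h.strictMonoOn_rho_mul ha hpos (left_mem_Icc.2 (hr.le.trans hrR)) ⟨hr.le, hrR⟩ hr
  simp only [h.v_zero, mul_zero] at this
  exact pos_of_mul_pos_right this (rho_pos n hr).le

lemma antitoneOn_f (hm : 1 < m) (h : IsFlow n m a f v) (ha : 0 < a) {R : ℝ}
    (hpos : ∀ s, 0 ≤ s → s < R → 0 < f s) : AntitoneOn f (Icc 0 R) := by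
  refine antitoneOn_of_hasDerivAt (F' := fun r => -(v r ^ m)) (convex_Icc 0 R)
    (h.continuousOn_f.mono fun x hx => hx.1) ?_ ?_ <;>
  · intro x hx
    rw [interior_Icc] at hx
    have := h.v_nonneg ha hpos hx.1.le hx.2.le
    first
    | exact h.hasDerivAt_f_of_nonneg hm hx.1 this
    | exact neg_nonpos.2 (Real.rpow_nonneg this _)

lemma exists_first_zero (h : IsFlow n m a f v) (ha : 0 < a) (hn : ∃ r, 0 ≤ r ∧ f r ≤ 0) :
    ∃ R, 0 < R ∧ (∀ s, 0 ≤ s → s < R → 0 < f s) ∧ f R = 0 := by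
  set S : Set ℝ := Ici 0 ∩ f ⁻¹' Iic 0
  have hS : IsClosed S := h.continuousOn_f.preimage_isClosed_of_isClosed isClosed_Ici isClosed_Iic
  have hbdd : BddBelow S := ⟨0, fun x hx => hx.1⟩
  obtain ⟨r, hr, hfr⟩ := hn
  have hmem : sInf S ∈ S := hS.csInf_mem ⟨r, hr, hfr⟩ hbdd
  have hR0 : 0 < sInf S := by
    refine lt_of_le_of_ne hmem.1 fun h0 => ?_
    have : f (sInf S) ≤ 0 := hmem.2
    rw [← h0, h.f_zero] at this
    linarith
  have hbefore : ∀ s, 0 ≤ s → s < sInf S → 0 < f s := fun s hs hsR => by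
    by_contra hcon
    exact notMem_of_lt_csInf hsR hbdd ⟨hs, not_lt.1 hcon⟩
  refine ⟨sInf S, hR0, hbefore, le_antisymm hmem.2 ?_⟩
  refine ge_of_tendsto
    ((h.hasDerivAt_f hR0).continuousAt.tendsto.mono_left (nhdsWithin_le_nhds (s := Iio (sInf S)))) ?_
  filter_upwards [Ioo_mem_nhdsLT hR0] with s hs using (hbefore s hs.1.le hs.2).le

/-- After its first zero, `f` takes negative values. -/
lemma exists_neg_of_zero (hm : 1 < m) (h : IsFlow n m a f v) (ha : 0 < a) {R : ℝ} (hR : 0 < R)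
    (hpos : ∀ s, 0 ≤ s → s < R → 0 < f s) (hfR : f R = 0) : ∃ s, R < s ∧ f s < 0 := by
  have hv := h.v_pos ha hpos hR le_rfl
  have hd := (h.hasDerivAt_f_of_nonneg hm hR hv.le)
  rw [hasDerivAt_iff_tendsto_slope] at hd
  have h1 := (hd.mono_left (nhdsWithin_mono R fun x (hx : x ∈ Ioi R) => ne_of_gt hx)).eventually_lt_const
    (neg_lt_zero.2 (Real.rpow_pos_of_pos hv m))
  obtain ⟨s, hs, hRs⟩ := (h1.and self_mem_nhdsWithin).exists
  refine ⟨s, hRs, ?_⟩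
  rw [slope_def_field, hfR, sub_zero] at hs
  have hRs : R < s := hRs
  rwa [div_lt_iff₀ (by linarith), zero_mul] at hs

/-! ### Positive solutions -/

lemma v_pos_of_pos (h : IsFlow n m a f v) (ha : 0 < a) (hpos : ∀ s, 0 ≤ s → 0 < f s) {r : ℝ}
    (hr : 0 < r) : 0 < v r :=
  h.v_pos ha (R := r) (fun s hs _ => hpos s hs) hr le_rfl

lemma monotoneOn_rho_mul (h : IsFlow n m a f v) (ha : 0 < a) (hpos : ∀ s, 0 ≤ s → 0 < f s) :
    MonotoneOn (fun r => rho n r * v r) (Ici 0) := fun _ hx y _ hxy =>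
  (h.strictMonoOn_rho_mul ha (R := y) fun s hs _ => hpos s hs).monotoneOn ⟨hx, hxy⟩
    ⟨le_trans hx hxy, le_rfl⟩ hxy

lemma antitoneOn_f_Ici (hm : 1 < m) (h : IsFlow n m a f v) (ha : 0 < a)
    (hpos : ∀ s, 0 ≤ s → 0 < f s) : AntitoneOn f (Ici 0) := fun _ hx y _ hxy =>
  (h.antitoneOn_f hm ha (R := y) fun s hs _ => hpos s hs) ⟨hx, hxy⟩ ⟨le_trans hx hxy, le_rfl⟩ hxy

/-- If `f` stayed above `ε > 0`, then `v` would stay above a positive constant, and `f' = -v ^ m`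
would force `f` to become negative. -/
lemma tendsto_f_zero (hm : 1 < m) (h : IsFlow n m a f v) (ha : 0 < a)
    (hpos : ∀ s, 0 ≤ s → 0 < f s) : Tendsto f atTop (𝓝 0) := by
  have key : ∀ ε > 0, ∃ r, 0 ≤ r ∧ f r < ε := by
    by_contra! hcon
    obtain ⟨ε, hε, hfε⟩ := hcon
    have hn : (0 : ℝ) < n + 1 := by positivity
    have h1 := eventually_le_of_deriv_le (u := -v)
      (u' := fun r => -(f r - |v r| - n / r * v r)) (r₀ := 1) (k := n + 1) (δ := -ε)
      (ε := ε / (2 * (n + 1))) hn (fun r hr => (h.deriv_v r (by linarith)).neg)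
      (fun r hr => by
        have hv := h.v_pos_of_pos ha hpos (r := r) (by linarith)
        have h2 : n / r * v r ≤ n * v r := by
          gcongr; exact div_le_self (by positivity) hr
        rw [abs_of_pos hv, Pi.neg_apply]
        linarith [hfε r (by linarith)]) (by positivity)
    obtain ⟨r₁, hr₁⟩ := eventually_atTop.1 (h1.and (eventually_ge_atTop 1))
    set c := ε / (2 * (n + 1)) with hc
    have hc0 : 0 < c := by positivity
    have hvc : ∀ r, r₁ ≤ r → c ≤ v r := fun r hr => by
      have := (hr₁ r hr).1
      have e : -ε / (n + 1) + c = -c := by rw [hc]; field_simp; ring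
      rw [e] at this
      simpa using this
    have hr1 : 1 ≤ r₁ := (hr₁ r₁ le_rfl).2
    have hanti : AntitoneOn (fun r => f r + c ^ m * r) (Ici r₁) := by
      have hd : ∀ r, r₁ ≤ r → HasDerivAt (fun r => f r + c ^ m * r) (-(v r ^ m) + c ^ m) r :=
        fun r hr => by
          have hv := h.v_pos_of_pos ha hpos (r := r) (by linarith)
          exact ((h.hasDerivAt_f_of_nonneg hm (by linarith) hv.le).add
            ((hasDerivAt_id r).const_mul (c ^ m))).congr_deriv (by simp)
      refine antitoneOn_of_hasDerivAt (convex_Ici r₁)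
        (fun r hr => (hd r hr).continuousAt.continuousWithinAt)
        (fun r hr => hd r (interior_subset hr)) fun r hr => ?_
      have := Real.rpow_le_rpow hc0.le (hvc r (interior_subset hr)) (by linarith : 0 ≤ m)
      linarith
    have hcm : 0 < c ^ m := Real.rpow_pos_of_pos hc0 m
    have h3 : 0 ≤ f r₁ / c ^ m := div_nonneg (hpos r₁ (by linarith)).le hcm.le
    have h2 := hanti self_mem_Ici (le_add_of_nonneg_right h3 : r₁ ≤ r₁ + f r₁ / c ^ m)
      (le_add_of_nonneg_right h3)
    simp only [mul_add, mul_div_cancel₀ _ hcm.ne'] at h2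
    have h4 := hpos (r₁ + f r₁ / c ^ m) (by linarith)
    linarith
  rw [Metric.tendsto_atTop]
  intro ε hε
  obtain ⟨r, hr, hfr⟩ := key ε hε
  refine ⟨r, fun s hs => ?_⟩
  rw [Real.dist_eq, sub_zero, abs_of_pos (hpos s (hr.trans hs))]
  exact (h.antitoneOn_f_Ici hm ha hpos hr (hr.trans hs) hs).trans_lt hfr

/-! ### The invariant region of slowly decaying solutions -/

lemma le_of_region_aux (hm : 1 < m) (h : IsFlow n m a f v) (ha : 0 < a) {σ r₁ R : ℝ}
    (hσ : 0 < σ) (hr₁ : 0 ≤ r₁) (hpos : ∀ s, 0 ≤ s → s < R → 0 < f s)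
    (hle : σ * v r₁ ≤ f r₁) (hsmall : (f r₁ / σ) ^ (m - 1) < σ * (1 - σ)) {r : ℝ} (hr : r₁ ≤ r)
    (hrR : r ≤ R) : σ * v r ≤ f r := by
  set d : ℝ → ℝ := fun r => if r = 0 then a / (n + 1) else f r - |v r| - n / r * v r with hd
  refine image_le_of_deriv_right_lt_deriv_boundary' (f := fun r => σ * v r)
    (f' := fun r => σ * d r) (B := f) (B' := fun r => -sPow m (v r)) (a := r₁) (b := r)
    (continuousOn_const.mul (h.continuousOn_v.mono fun x hx => hr₁.trans hx.1))
    (fun x hx => by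
      rcases (hr₁.trans hx.1).eq_or_lt with rfl | hx0
      · simpa [hd] using h.deriv_v_zero.const_mul σ
      · simpa only [hd, hx0.ne', if_false] using
          ((h.deriv_v x hx0).const_mul σ).hasDerivWithinAt)
    hle (h.continuousOn_f.mono fun x hx => hr₁.trans hx.1)
    (fun x hx => (h.deriv_f x (hr₁.trans hx.1)).mono (Ici_subset_Ici.2 (hr₁.trans hx.1)))
    (fun x hx hvx => ?_)
    (right_mem_Icc.2 hr)
  have hxR : x < R := hx.2.trans_le hrR
  have hfx := hpos x (hr₁.trans hx.1) hxR
  rcases (hr₁.trans hx.1).eq_or_lt with rfl | hx0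
  · rw [h.v_zero] at hvx
    linarith
  have hv := h.v_pos ha hpos hx0 hxR.le
  simp only [hd, hx0.ne', if_false]
  rw [abs_of_pos hv, sPow_of_nonneg hm hv.le, ← hvx]
  have hanti := h.antitoneOn_f hm ha hpos ⟨hr₁, hx.1.trans hxR.le⟩ ⟨hx0.le, hxR.le⟩ hx.1
  have h1 : v x ^ (m - 1) < σ * (1 - σ) := by
    have e : v x = f x / σ := by rw [eq_div_iff hσ.ne', ← hvx]; ring
    rw [e]
    refine (Real.rpow_le_rpow (by positivity) ?_ (by linarith)).trans_lt hsmall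
    gcongr
  have h2 : v x ^ m = v x ^ (m - 1) * v x := by
    rw [← Real.rpow_add_one hv.ne']; simp
  rw [h2]
  have h3 : 0 ≤ σ * (n / x * v x) := by positivity
  have h4 := mul_lt_mul_of_pos_right h1 hv
  nlinarith

/-- The region `σ v ≤ f`, `(f / σ) ^ (m - 1) < σ (1 - σ)` is positively invariant, since on its
boundary `σ v = f` the vector field points inwards. In particular a solution that enters it
while positive remains positive. -/
lemma pos_and_le_of_region (hm : 1 < m) (h : IsFlow n m a f v) (ha : 0 < a) {σ r₁ : ℝ}
    (hσ : 0 < σ) (hr₁ : 0 ≤ r₁) (hpos : ∀ s ∈ Icc 0 r₁, 0 < f s)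
    (hle : σ * v r₁ ≤ f r₁) (hsmall : (f r₁ / σ) ^ (m - 1) < σ * (1 - σ)) :
    (∀ s, 0 ≤ s → 0 < f s) ∧ ∀ r, r₁ ≤ r → σ * v r ≤ f r := by
  have hall : ∀ s, 0 ≤ s → 0 < f s := by
    by_contra! hcon
    obtain ⟨R, hR, hposR, hfR⟩ := h.exists_first_zero ha hcon
    have hr₁R : r₁ ≤ R := by
      by_contra! hlt
      exact (hpos R ⟨hR.le, hlt.le⟩).ne' hfR
    have h1 := h.le_of_region_aux hm ha hσ hr₁ hposR hle hsmall hr₁R le_rfl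
    have h2 := mul_pos hσ (h.v_pos ha hposR hR le_rfl)
    linarith
  exact ⟨hall, fun r hr => h.le_of_region_aux hm ha hσ hr₁ (fun s hs _ => hall s hs) hle hsmall hr
    le_rfl⟩

/-- A positive solution for which eventually `f ≤ σ v` with a small `σ` decays fast, in the sense
that `ρ v` is bounded. -/
lemma bounded_of_eventually_le (hm : 1 < m) (h : IsFlow n m a f v) (ha : 0 < a)
    (hpos : ∀ s, 0 ≤ s → 0 < f s)
    (hle : ∀ᶠ r in atTop, f r ≤ (m - 1) / (2 * m) * v r) :
    ∃ C, ∀ r, 0 ≤ r → rho n r * v r ≤ C := by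
  set σ := (m - 1) / (2 * m) with hσ
  have hσm : (σ - 1) * m = -((m + 1) / 2) := by rw [hσ]; field_simp; ring
  obtain ⟨r₀, hr₀⟩ := eventually_atTop.1 (hle.and (eventually_ge_atTop 1))
  have hr1 : 1 ≤ r₀ := (hr₀ r₀ le_rfl).2
  have hv : ∀ r, r₀ ≤ r → 0 < v r := fun r hr => h.v_pos_of_pos ha hpos (by linarith)
  have hexp : ∀ (k r : ℝ), HasDerivAt (fun r => Real.exp (k * r)) (Real.exp (k * r) * k) r :=
    fun k r => by simpa using ((hasDerivAt_id r).const_mul k).exp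
  -- first bound: `ρ v` grows at most like `exp (σ r)`
  have h1 : AntitoneOn (fun r => rho n r * v r * Real.exp (-σ * r)) (Ici r₀) := by
    have hd : ∀ r, r₀ ≤ r → HasDerivAt (fun r => rho n r * v r * Real.exp (-σ * r))
        (rho n r * (f r - σ * v r) * Real.exp (-σ * r)) r := fun r hr =>
      ((h.hasDerivAt_rho_mul (by linarith) (hv r hr).le).mul (hexp (-σ) r)).congr_deriv (by ring)
    refine antitoneOn_of_hasDerivAt (convex_Ici r₀)
      (fun r hr => (hd r hr).continuousAt.continuousWithinAt)
      (fun r hr => hd r (interior_subset hr)) fun r hr => ?_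
    have hr : r₀ ≤ r := interior_subset hr
    exact mul_nonpos_of_nonpos_of_nonneg (mul_nonpos_of_nonneg_of_nonpos
      (rho_nonneg n (by linarith)) (by linarith [(hr₀ r hr).1])) (Real.exp_pos _).le
  set C := rho n r₀ * v r₀ * Real.exp (-σ * r₀) with hC
  have hC0 : 0 < C := mul_pos (mul_pos (rho_pos n (by linarith)) (hv r₀ le_rfl)) (Real.exp_pos _)
  have h2 : ∀ r, r₀ ≤ r → v r ≤ C * Real.exp ((σ - 1) * r) := fun r hr => by
    have h3 : rho n r * v r * Real.exp (-σ * r) ≤ C := h1 self_mem_Ici hr hr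
    have h4 : Real.exp r * v r * Real.exp (-σ * r) ≤ C := by
      refine le_trans ?_ h3
      have := exp_le_rho n (hr1.trans hr)
      have := (hv r hr).le
      gcongr
    calc v r = (Real.exp r * v r * Real.exp (-σ * r)) * Real.exp ((σ - 1) * r) := by
          have : Real.exp r * Real.exp (-σ * r) * Real.exp ((σ - 1) * r) = 1 := by
            rw [← Real.exp_add, ← Real.exp_add, show r + -σ * r + (σ - 1) * r = 0 by ring,
              Real.exp_zero]
          linear_combination (-v r) * this
      _ ≤ _ := by gcongr
  -- second bound: `f` decays faster than `exp (-r)`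
  set κ := (m + 1) / 2 with hκ
  set K := C ^ m / κ with hK
  have hκ0 : 0 < κ := by positivity
  have hCm : 0 < C ^ m := Real.rpow_pos_of_pos hC0 m
  have hK0 : 0 < K := by positivity
  have h3 : MonotoneOn (fun r => f r - K * Real.exp (-κ * r)) (Ici r₀) := by
    have hd : ∀ r, r₀ ≤ r → HasDerivAt (fun r => f r - K * Real.exp (-κ * r))
        (-(v r ^ m) + C ^ m * Real.exp (-κ * r)) r := fun r hr =>
      ((h.hasDerivAt_f_of_nonneg hm (by linarith) (hv r hr).le).sub
        ((hexp (-κ) r).const_mul K)).congr_deriv (by rw [hK]; field_simp; ring)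
    refine monotoneOn_of_hasDerivAt (convex_Ici r₀)
      (fun r hr => (hd r hr).continuousAt.continuousWithinAt)
      (fun r hr => hd r (interior_subset hr)) fun r hr => ?_
    have hr : r₀ ≤ r := interior_subset hr
    have h4 := Real.rpow_le_rpow (hv r hr).le (h2 r hr) (by linarith : 0 ≤ m)
    rw [Real.mul_rpow hC0.le (Real.exp_pos _).le, ← Real.exp_mul, mul_right_comm, hσm] at h4
    linarith
  have hlim : Tendsto (fun r => f r - K * Real.exp (-κ * r)) atTop (𝓝 0) := by
    have h5 : Tendsto (fun r => Real.exp (-κ * r)) atTop (𝓝 0) :=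
      Real.tendsto_exp_atBot.comp (tendsto_id.const_mul_atTop_of_neg (by linarith))
    simpa using (h.tendsto_f_zero hm ha hpos).sub (h5.const_mul K)
  have h6 : ∀ r, r₀ ≤ r → f r ≤ K * Real.exp (-κ * r) := fun r hr => by
    have : f r - K * Real.exp (-κ * r) ≤ 0 := by
      refine ge_of_tendsto hlim ?_
      filter_upwards [eventually_ge_atTop r] with s hs using h3 hr (hr.trans hs) hs
    linarith
  -- hence `(ρ v)' = ρ f` is integrable
  set τ := (m - 1) / 4 with hτ
  have hτ0 : 0 < τ := by rw [hτ]; linarith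
  have h7 : ∀ᶠ r : ℝ in atTop, r ^ n ≤ Real.exp (τ * r) := by
    filter_upwards [(isLittleO_pow_exp_pos_mul_atTop n hτ0).bound zero_lt_one,
      eventually_ge_atTop 0] with r hr hr0
    simpa [abs_of_nonneg hr0] using hr
  obtain ⟨r₂, hr₂⟩ := eventually_atTop.1 (h7.and (eventually_ge_atTop r₀))
  have hr02 : r₀ ≤ r₂ := (hr₂ r₂ le_rfl).2
  have h8 : AntitoneOn (fun r => rho n r * v r + K / τ * Real.exp (-τ * r)) (Ici r₂) := by
    have hd : ∀ r, r₂ ≤ r → HasDerivAt (fun r => rho n r * v r + K / τ * Real.exp (-τ * r))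
        (rho n r * f r - K * Real.exp (-τ * r)) r := fun r hr =>
      ((h.hasDerivAt_rho_mul (by linarith) (hv r (hr02.trans hr)).le).add
        ((hexp (-τ) r).const_mul (K / τ))).congr_deriv (by field_simp; ring)
    refine antitoneOn_of_hasDerivAt (convex_Ici r₂)
      (fun r hr => (hd r hr).continuousAt.continuousWithinAt)
      (fun r hr => hd r (interior_subset hr)) fun r hr => ?_
    have hr : r₂ ≤ r := interior_subset hr
    have hle : rho n r * f r ≤ Real.exp (τ * r) * Real.exp r * (K * Real.exp (-κ * r)) := by
      unfold rho
      have := (hr₂ r hr).1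
      have := h6 r (hr02.trans hr)
      have := (hpos r (by linarith)).le
      gcongr
    have e : Real.exp (τ * r) * Real.exp r * (K * Real.exp (-κ * r)) = K * Real.exp (-τ * r) := by
      rw [mul_left_comm, ← Real.exp_add, ← Real.exp_add]
      congr 2
      rw [hτ, hκ]; ring
    linarith
  refine ⟨rho n r₂ * v r₂ + K / τ * Real.exp (-τ * r₂), fun r hr => ?_⟩
  have hmono := h.monotoneOn_rho_mul ha hpos
  have hKτ : ∀ r, 0 ≤ K / τ * Real.exp (-τ * r) := fun r => by positivity
  have hA : rho n r * v r ≤ rho n (max r r₂) * v (max r r₂) :=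
    hmono hr (hr.trans (le_max_left r r₂)) (le_max_left _ _)
  have hB := h8 self_mem_Ici (le_max_right r r₂ : r₂ ≤ max r r₂) (le_max_right r r₂)
  simp only at hB
  linarith [hKτ (max r r₂)]

end IsFlow

/-! ### Existence of a fast decaying solution -/

/-- A positive solution decays fast if `ρ v`, which is increasing, stays bounded. -/
def IsFast (n : ℕ) (f v : ℝ → ℝ) : Prop :=
  (∀ s, 0 ≤ s → 0 < f s) ∧ ∃ C, ∀ r, 0 ≤ r → rho n r * v r ≤ C

/-- The aperture of the invariant region of slowly decaying solutions. Below `(m - 1) / m` it is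
small enough for solutions that remain outside the region to decay fast. -/
noncomputable def slowRatio (m : ℝ) : ℝ := (m - 1) / (2 * m)

/-- The solution reaches, while still positive, the interior of the invariant region of
`IsFlow.pos_and_le_of_region`. -/
def EntersRegion (m : ℝ) (f v : ℝ → ℝ) : Prop :=
  ∃ r, 0 ≤ r ∧ (∀ s ∈ Icc 0 r, 0 < f s) ∧ slowRatio m * v r < f r ∧
    (f r / slowRatio m) ^ (m - 1) < slowRatio m * (1 - slowRatio m)

lemma slowRatio_pos {m : ℝ} (hm : 1 < m) : 0 < slowRatio m :=
  div_pos (by linarith) (by linarith)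

lemma slowRatio_lt_one {m : ℝ} (hm : 1 < m) : slowRatio m < 1 := by
  rw [slowRatio, div_lt_one (by linarith)]; linarith

namespace IsFlow

variable {n : ℕ} {m a b : ℝ} {f v g w : ℝ → ℝ}

lemma pos_of_entersRegion (hm : 1 < m) (h : IsFlow n m a f v) (ha : 0 < a)
    (hE : EntersRegion m f v) : ∀ s, 0 ≤ s → 0 < f s := by
  obtain ⟨r, hr, hpos, hle, hs⟩ := hE
  exact (h.pos_and_le_of_region hm ha (slowRatio_pos hm) hr hpos hle.le hs).1

lemma isFast_or_entersRegion (hm : 1 < m) (h : IsFlow n m a f v) (ha : 0 < a)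
    (hpos : ∀ s, 0 ≤ s → 0 < f s) : IsFast n f v ∨ EntersRegion m f v := by
  by_contra! hcon
  refine hcon.1 ⟨hpos, h.bounded_of_eventually_le hm ha hpos ?_⟩
  have hσ := slowRatio_pos hm
  have h1 : Tendsto (fun r => (f r / slowRatio m) ^ (m - 1)) atTop (𝓝 0) := by
    have := ((h.tendsto_f_zero hm ha hpos).div_const (slowRatio m)).rpow_const (p := m - 1)
      (Or.inr (by linarith))
    rwa [zero_div, Real.zero_rpow (by linarith)] at this
  have h2 : 0 < slowRatio m * (1 - slowRatio m) := mul_pos hσ (by linarith [slowRatio_lt_one hm])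
  filter_upwards [h1.eventually_lt_const h2, eventually_ge_atTop 0] with r hr hr0
  by_contra! hlt
  exact hcon.2 ⟨r, hr0, fun s hs => hpos s hs.1, hlt, hr⟩

lemma le_rho_mul_of_le (h : IsFlow n m a f v) (ha : 0 < a) {R c : ℝ} (hc : 0 < c) (hR : 0 ≤ R)
    (hpos : ∀ s, 0 ≤ s → s ≤ R → c ≤ f s) : c * (R ^ (n + 1) / (n + 1)) ≤ rho n R * v R := by
  have hmono : MonotoneOn (fun r => rho n r * v r - c * (r ^ (n + 1) / (n + 1))) (Icc 0 R) := by
    refine monotoneOn_of_hasDerivAt (F' := fun r => rho n r * f r - c * r ^ n) (convex_Icc 0 R)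
      ?_ ?_ ?_
    · have h1 := h.continuousOn_v.mono (fun x hx => hx.1 : Icc 0 R ⊆ Ici 0)
      have h2 := continuous_rho n
      fun_prop
    · intro x hx
      rw [interior_Icc] at hx
      have hv := h.v_nonneg ha (R := R) (fun s hs hsR => hc.trans_le (hpos s hs hsR.le)) hx.1.le
        hx.2.le
      refine ((h.hasDerivAt_rho_mul hx.1 hv).sub
        (((hasDerivAt_pow (n + 1) x).div_const _).const_mul c)).congr_deriv ?_
      push_cast
      field_simp
    · intro x hx
      rw [interior_Icc] at hx
      have h1 := hpos x hx.1.le hx.2.le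
      have h2 := pow_le_rho n hx.1.le
      have h3 := pow_nonneg hx.1.le n
      have := mul_le_mul h2 h1 hc.le (h3.trans h2)
      linarith
  have := hmono (left_mem_Icc.2 hR) (right_mem_Icc.2 hR) hR
  simp only [h.v_zero, mul_zero, ne_eq, Nat.add_eq_zero_iff, one_ne_zero, and_false,
    not_false_eq_true, zero_pow, zero_div, sub_zero] at this
  linarith

/-- For large `a` the solution crosses zero. On the intrinsic length scale
`a ^ (-(m - 1) / (m + 1))` the quantity `ρ v` reaches a power of `a` that is positive because
`n m < n + 2`, while the value of `ρ v` at `1` is bounded independently of `a` for a solution that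
is positive on `[0, 2]`. -/
lemma exists_not_pos (n : ℕ) (hm : 1 < m) (hnm : n * m < n + 2) :
    ∃ a, 0 < a ∧ ∀ f v, IsFlow n m a f v → ∃ s, 0 ≤ s ∧ f s ≤ 0 := by
  set β : ℝ := (n + 2 - n * m) / (m + 1) with hβ
  have hβ0 : 0 < β := div_pos (by linarith) (by linarith)
  have hn1 : (0 : ℝ) < n + 1 := by positivity
  have hlim : Tendsto (fun a : ℝ => (a ^ β / (2 * (n + 1))) ^ (m - 1)) atTop atTop :=
    (tendsto_rpow_atTop (by linarith)).comp
      ((tendsto_rpow_atTop hβ0).atTop_div_const (by positivity))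
  obtain ⟨a, haL, ha1⟩ := ((hlim.eventually_gt_atTop ((n + 1) * rho n 2 ^ m)).and
    (eventually_ge_atTop 1)).exists
  have ha : 0 < a := by linarith
  refine ⟨a, ha, fun f v h => ?_⟩
  by_contra! hpos
  have hanti := h.antitoneOn_f_Ici hm ha hpos
  have hfa : ∀ r, 0 ≤ r → f r ≤ a := fun r hr => by
    simpa [h.f_zero] using hanti self_mem_Ici hr hr
  have hva : ∀ r, 0 ≤ r → v r ≤ a * r := by
    have hmono : MonotoneOn (fun r => a * r - v r) (Ici 0) := by
      refine monotoneOn_of_hasDerivAt (F' := fun r => a - (f r - |v r| - n / r * v r))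
        (convex_Ici 0) ?_ ?_ ?_
      · have := h.continuousOn_v
        fun_prop
      · intro x hx
        rw [interior_Ici] at hx
        exact (((hasDerivAt_id x).const_mul a).sub (h.deriv_v x hx)).congr_deriv (by simp)
      · intro x hx
        rw [interior_Ici] at hx
        have hx : 0 < x := hx
        have h1 := h.v_pos_of_pos ha hpos hx
        have h2 : 0 ≤ n / x * v x := by positivity
        rw [abs_of_pos h1]
        linarith [hfa x hx.le]
    intro r hr
    have := hmono self_mem_Ici hr hr
    simp only [h.v_zero, mul_zero, sub_zero] at this
    linarith
  have hflow : ∀ r, 0 ≤ r → a - a ^ m * (r ^ (m + 1) / (m + 1)) ≤ f r := by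
    have hmono : MonotoneOn (fun r => f r + a ^ m * (r ^ (m + 1) / (m + 1))) (Ici 0) := by
      refine monotoneOn_of_hasDerivAt (F' := fun r => -(v r ^ m) + a ^ m * r ^ m)
        (convex_Ici 0) ?_ ?_ ?_
      · have h1 := h.continuousOn_f
        have h2 : Continuous fun r : ℝ => r ^ (m + 1) :=
          continuous_id.rpow_const fun x => Or.inr (by linarith)
        fun_prop
      · intro x hx
        rw [interior_Ici] at hx
        have hx : 0 < x := hx
        refine ((h.hasDerivAt_f_of_nonneg hm hx (h.v_pos_of_pos ha hpos hx).le).add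
          (((Real.hasDerivAt_rpow_const (p := m + 1) (Or.inl hx.ne')).div_const (m + 1)).const_mul
            (a ^ m))).congr_deriv ?_
        rw [add_sub_cancel_right]
        field_simp
      · intro x hx
        rw [interior_Ici] at hx
        have hx : 0 < x := hx
        have := Real.rpow_le_rpow (h.v_pos_of_pos ha hpos hx).le (hva x hx.le)
          (by linarith : 0 ≤ m)
        rw [Real.mul_rpow ha.le hx.le] at this
        linarith
    intro r hr
    have := hmono self_mem_Ici hr hr
    simp only [h.f_zero] at this
    rw [Real.zero_rpow (by linarith)] at this
    simp only [zero_div, mul_zero, add_zero] at this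
    linarith
  set l := a ^ ((1 - m) / (m + 1)) with hl
  have hl0 : 0 < l := Real.rpow_pos_of_pos ha _
  have hl1 : l ≤ 1 := Real.rpow_le_one_of_one_le_of_nonpos ha1
    (div_nonpos_of_nonpos_of_nonneg (by linarith) (by linarith))
  have hlm : a ^ m * l ^ (m + 1) = a := by
    rw [hl, ← Real.rpow_mul ha.le, div_mul_cancel₀ _ (by linarith : m + 1 ≠ 0),
      ← Real.rpow_add ha]
    simp
  have hhalf : ∀ s, 0 ≤ s → s ≤ l → a / 2 ≤ f s := fun s hs hsl => by
    refine le_trans ?_ (hflow s hs)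
    have h1 := Real.rpow_le_rpow hs hsl (by linarith : 0 ≤ m + 1)
    have h2 : 0 < a ^ m := Real.rpow_pos_of_pos ha m
    have h3 : a ^ m * (s ^ (m + 1) / (m + 1)) ≤ a ^ m * (l ^ (m + 1) / (m + 1)) := by gcongr
    have h4 : a ^ m * (l ^ (m + 1) / (m + 1)) = a / (m + 1) := by rw [← mul_div_assoc, hlm]
    have h5 : a / (m + 1) ≤ a / 2 := by
      gcongr; linarith
    linarith
  have hV1 := h.monotoneOn_rho_mul ha hpos hl0.le (mem_Ici.2 zero_le_one) hl1
  simp only at hV1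
  set V := rho n 1 * v 1 with hV
  have hVlow : a ^ β / (2 * (n + 1)) ≤ V := by
    refine le_trans ?_ ((h.le_rho_mul_of_le ha (by positivity) hl0.le hhalf).trans hV1)
    have : a * l ^ (n + 1) = a ^ β := by
      rw [hl, ← Real.rpow_natCast, ← Real.rpow_mul ha.le]
      nth_rw 1 [← Real.rpow_one a]
      rw [← Real.rpow_add ha]
      congr 1
      rw [hβ]
      push_cast
      field_simp
      ring
    rw [← this]
    apply le_of_eq
    field_simp
  have hV0 : 0 < V := lt_of_lt_of_le (by positivity) hVlow
  have hVf : f 1 / (n + 1) ≤ V := by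
    have := h.le_rho_mul_of_le ha (hpos 1 zero_le_one) zero_le_one
      (fun s hs hs1 => hanti hs (mem_Ici.2 zero_le_one) hs1)
    simpa [← div_eq_mul_inv] using this
  have hρ2 : 0 < rho n 2 := rho_pos n two_pos
  have hf1 : (V / rho n 2) ^ m ≤ f 1 := by
    have hanti2 : AntitoneOn (fun r => f r + (V / rho n 2) ^ m * r) (Icc 1 2) := by
      refine antitoneOn_of_hasDerivAt (F' := fun r => -(v r ^ m) + (V / rho n 2) ^ m)
        (convex_Icc 1 2) ?_ ?_ ?_
      · have h1 := h.continuousOn_f.mono (fun x hx => zero_le_one.trans hx.1 : Icc 1 2 ⊆ Ici (0 : ℝ))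
        fun_prop
      · intro x hx
        rw [interior_Icc] at hx
        have hx0 : 0 < x := by linarith [hx.1]
        exact ((h.hasDerivAt_f_of_nonneg hm hx0 (h.v_pos_of_pos ha hpos hx0).le).add
          ((hasDerivAt_id x).const_mul _)).congr_deriv (by simp)
      · intro x hx
        rw [interior_Icc] at hx
        have hx0 : 0 < x := by linarith [hx.1]
        have h1 := h.monotoneOn_rho_mul ha hpos (mem_Ici.2 zero_le_one) hx0.le hx.1.le
        simp only [← hV] at h1
        have h2 : V / rho n 2 ≤ v x := by
          rw [div_le_iff₀ hρ2, mul_comm]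
          have := rho_mono n hx0.le hx.2.le
          have := (h.v_pos_of_pos ha hpos hx0).le
          exact h1.trans (by gcongr)
        have := Real.rpow_le_rpow (by positivity) h2 (by linarith : 0 ≤ m)
        linarith
    have := hanti2 (left_mem_Icc.2 one_le_two) (right_mem_Icc.2 one_le_two) one_le_two
    simp only at this
    linarith [hpos 2 zero_le_two]
  have hfin : V ^ (m - 1) ≤ (n + 1) * rho n 2 ^ m := by
    have h1 : (V / rho n 2) ^ m ≤ V * (n + 1) := hf1.trans (by rwa [div_le_iff₀ hn1] at hVf)
    rw [Real.div_rpow hV0.le hρ2.le, div_le_iff₀ (Real.rpow_pos_of_pos hρ2 m)] at h1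
    have h2 : V ^ m = V ^ (m - 1) * V := by rw [← Real.rpow_add_one hV0.ne']; simp
    rw [h2] at h1
    refine le_of_mul_le_mul_right (h1.trans_eq ?_) hV0
    ring
  have := Real.rpow_le_rpow (by positivity) hVlow (by linarith : 0 ≤ m - 1)
  linarith

/-- By connectedness of `(0, ∞)`: the initial values of solutions that change sign, and those of
solutions entering the invariant region, form two disjoint nonempty open sets. -/
theorem exists_isFast {F W : ℝ → ℝ → ℝ} (hm : 1 < m) (hnm : n * m < n + 2)
    (hF : ∀ a, IsFlow n m a (F a) (W a)) : ∃ a, 0 < a ∧ IsFast n (F a) (W a) := by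
  by_contra! hcon
  have htF : ∀ a r, 0 ≤ r → Tendsto (fun b => F b r) (𝓝 a) (𝓝 (F a r)) := fun a r hr => by
    refine Metric.tendsto_nhds.2 fun ε hε => ?_
    filter_upwards [eventually_close hm hF a r hε] with b hb
    exact (hb r (right_mem_Icc.2 hr)).1
  have htW : ∀ a r, 0 ≤ r → Tendsto (fun b => W b r) (𝓝 a) (𝓝 (W a r)) := fun a r hr => by
    refine Metric.tendsto_nhds.2 fun ε hε => ?_
    filter_upwards [eventually_close hm hF a r hε] with b hb
    exact (hb r (right_mem_Icc.2 hr)).2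
  have hσ := slowRatio_pos hm
  have hC : IsOpen {a | 0 < a ∧ ∃ s, 0 ≤ s ∧ F a s < 0} := by
    rw [isOpen_iff_mem_nhds]
    rintro a ⟨ha, s, hs, hneg⟩
    filter_upwards [lt_mem_nhds ha, (htF a s hs).eventually_lt_const hneg] with b hb hb2
    exact ⟨hb, s, hs, hb2⟩
  have hE : IsOpen {a | 0 < a ∧ EntersRegion m (F a) (W a)} := by
    rw [isOpen_iff_mem_nhds]
    rintro a ⟨ha, r, hr, hpos, hlt, hsm⟩
    have h1 := ((htW a r hr).const_mul (slowRatio m)).eventually_lt (htF a r hr) hlt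
    have h2 := (((htF a r hr).div_const (slowRatio m)).rpow_const (p := m - 1)
      (Or.inr (by linarith))).eventually_lt_const hsm
    have hr0 : 0 < F a r := hpos r (right_mem_Icc.2 hr)
    filter_upwards [lt_mem_nhds ha, h1, h2, eventually_close hm hF a r hr0] with b hb h1 h2 h3
    refine ⟨hb, r, hr, fun s hs => ?_, h1, h2⟩
    have h4 := abs_lt.1 (h3 s hs).1
    have hpos' := (hF a).pos_of_entersRegion hm ha ⟨r, hr, hpos, hlt, hsm⟩
    have h5 := (hF a).antitoneOn_f_Ici hm ha hpos' hs.1 hr hs.2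
    linarith
  have hmeet : (Ioi (0 : ℝ) ∩ ({a | 0 < a ∧ ∃ s, 0 ≤ s ∧ F a s < 0} ∩
      {a | 0 < a ∧ EntersRegion m (F a) (W a)})).Nonempty := by
    refine isPreconnected_Ioi _ _ hC hE ?_ ?_ ?_
    · intro a ha
      have ha : 0 < a := ha
      by_cases hpos : ∀ s, 0 ≤ s → 0 < F a s
      · exact Or.inr ⟨ha, ((hF a).isFast_or_entersRegion hm ha hpos).resolve_left (hcon a ha)⟩
      · push Not at hpos
        obtain ⟨R, hR, hposR, hFR⟩ := (hF a).exists_first_zero ha hpos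
        obtain ⟨s, hs, hneg⟩ := (hF a).exists_neg_of_zero hm ha hR hposR hFR
        exact Or.inl ⟨ha, s, (hR.trans hs).le, hneg⟩
    · obtain ⟨a, ha, h⟩ := exists_not_pos n hm hnm
      obtain ⟨R, hR, hposR, hFR⟩ := (hF a).exists_first_zero ha (h _ _ (hF a))
      obtain ⟨s, hs, hneg⟩ := (hF a).exists_neg_of_zero hm ha hR hposR hFR
      exact ⟨a, ha, ha, s, (hR.trans hs).le, hneg⟩
    · have h1 : Tendsto (fun a : ℝ => (a / slowRatio m) ^ (m - 1)) (𝓝[>] 0) (𝓝 0) := by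
        have := ((tendsto_id (x := 𝓝 (0 : ℝ))).div_const (slowRatio m)).rpow_const (p := m - 1)
          (Or.inr (by linarith))
        simp only [id, zero_div] at this
        rw [Real.zero_rpow (by linarith)] at this
        exact this.mono_left nhdsWithin_le_nhds
      have h2 : 0 < slowRatio m * (1 - slowRatio m) :=
        mul_pos hσ (by linarith [slowRatio_lt_one hm])
      obtain ⟨a, ha1, ha⟩ := ((h1.eventually_lt_const h2).and self_mem_nhdsWithin).exists
      have ha : 0 < a := ha
      refine ⟨a, ha, ha, 0, le_rfl, fun s hs => ?_, ?_, ?_⟩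
      · rw [le_antisymm hs.2 hs.1, (hF a).f_zero]; exact ha
      · rw [(hF a).f_zero, (hF a).v_zero, mul_zero]; exact ha
      · rwa [(hF a).f_zero]
  obtain ⟨a, -, ⟨ha, s, hs, hneg⟩, -, hEa⟩ := hmeet
  have := (hF a).pos_of_entersRegion hm ha hEa s hs
  linarith

end IsFlow

/-! ### Asymptotic behaviour -/

/-- One half of `y' → ℓ ⟹ y / r → ℓ`. -/
lemma eventually_div_le_of_deriv {y y' : ℝ → ℝ} {ℓ ε : ℝ} (hε : 0 < ε)
    (hy : ∀ᶠ r in atTop, HasDerivAt y (y' r) r) (h : Tendsto y' atTop (𝓝 ℓ)) :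
    ∀ᶠ r in atTop, y r / r ≤ ℓ + ε := by
  obtain ⟨r₀, hr₀⟩ := eventually_atTop.1
    (hy.and (h.eventually_lt_const (by linarith : ℓ < ℓ + ε / 2)))
  have hanti : AntitoneOn (fun r => y r - (ℓ + ε / 2) * r) (Ici r₀) := by
    have hd : ∀ r, r₀ ≤ r → HasDerivAt (fun r => y r - (ℓ + ε / 2) * r) (y' r - (ℓ + ε / 2)) r :=
      fun r hr => ((hr₀ r hr).1.sub ((hasDerivAt_id r).const_mul (ℓ + ε / 2))).congr_deriv
        (by simp)
    refine antitoneOn_of_hasDerivAt (convex_Ici r₀)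
      (fun r hr => (hd r hr).continuousAt.continuousWithinAt)
      (fun r hr => hd r (interior_subset hr)) fun r hr => ?_
    linarith [(hr₀ r (interior_subset hr)).2]
  set c := y r₀ - (ℓ + ε / 2) * r₀ with hc
  have h1 : ∀ᶠ r : ℝ in atTop, c ≤ ε / 2 * r :=
    (tendsto_id.const_mul_atTop (by positivity : 0 < ε / 2)).eventually_ge_atTop c
  filter_upwards [h1, eventually_gt_atTop 0, eventually_ge_atTop r₀] with r h1 h2 h3
  have := hanti self_mem_Ici h3 h3
  simp only [← hc] at this
  rw [div_le_iff₀ h2]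
  linarith

lemma tendsto_div_of_deriv {y y' : ℝ → ℝ} {ℓ : ℝ}
    (hy : ∀ᶠ r in atTop, HasDerivAt y (y' r) r) (h : Tendsto y' atTop (𝓝 ℓ)) :
    Tendsto (fun r => y r / r) atTop (𝓝 ℓ) := by
  refine Metric.tendsto_nhds.2 fun ε hε => ?_
  filter_upwards [eventually_div_le_of_deriv (half_pos hε) hy h,
    eventually_div_le_of_deriv (half_pos hε) (hy.mono fun r hr => hr.neg) h.neg] with r h1 h2
  rw [Pi.neg_apply, neg_div] at h2
  rw [Real.dist_eq, abs_lt]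
  constructor <;> linarith

namespace IsFlow

variable {n : ℕ} {m a b : ℝ} {f v g w : ℝ → ℝ}

lemma _root_.IsFast.tendsto_rho_mul (h : IsFlow n m a f v) (ha : 0 < a) (hf : IsFast n f v) :
    ∃ l, 0 < l ∧ Tendsto (fun r => rho n r * v r) atTop (𝓝 l) := by
  obtain ⟨hpos, C, hC⟩ := hf
  have hmono := h.monotoneOn_rho_mul ha hpos
  have hm' : Monotone fun r => rho n (max r 0) * v (max r 0) := fun x y hxy =>
    hmono (le_max_right x 0) (le_max_right y 0) (max_le_max_right 0 hxy)
  have hb : BddAbove (range fun r => rho n (max r 0) * v (max r 0)) :=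
    ⟨C, by rintro _ ⟨r, rfl⟩; exact hC _ (le_max_right r 0)⟩
  have hlim := tendsto_atTop_ciSup hm' hb
  refine ⟨_, ?_, hlim.congr' ?_⟩
  · have h1 := le_ciSup hb 1
    rw [max_eq_left zero_le_one] at h1
    exact (mul_pos (rho_pos n one_pos) (h.v_pos_of_pos ha hpos one_pos)).trans_le h1
  · filter_upwards [eventually_ge_atTop 0] with r hr
    rw [max_eq_left hr]

lemma tendsto_drift (n : ℕ) : Tendsto (fun r : ℝ => 1 + n / r) atTop (𝓝 1) := by
  simpa using (tendsto_const_nhds (x := (n : ℝ)).div_atTop tendsto_id).const_add 1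

lemma tendsto_rho_atTop (n : ℕ) : Tendsto (rho n) atTop atTop := by
  refine tendsto_atTop_mono' _ ?_ Real.tendsto_exp_atTop
  filter_upwards [eventually_ge_atTop 1] with r hr using exp_le_rho n hr

lemma tendsto_rho_rpow_neg (n : ℕ) {k : ℝ} (hk : 0 < k) :
    Tendsto (fun r => rho n r ^ (-k)) atTop (𝓝 0) :=
  (tendsto_rpow_neg_atTop hk).comp (tendsto_rho_atTop n)

/-- Fast decaying solutions are asymptotically proportional to `ρ ^ (-m)`, by l'Hôpital's rule. -/
lemma _root_.IsFast.tendsto_div (hm : 1 < m) (h : IsFlow n m a f v) (ha : 0 < a) (hf : IsFast n f v) :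
    ∃ c, 0 < c ∧ Tendsto (fun r => f r / rho n r ^ (-m)) atTop (𝓝 c) := by
  obtain ⟨l, hl, hlim⟩ := IsFast.tendsto_rho_mul h ha hf
  refine ⟨l ^ m / (m * 1), by positivity, ?_⟩
  refine HasDerivAt.lhopital_zero_atTop (f' := fun r => -(v r ^ m))
    (g' := fun r => -(m * (1 + n / r) * rho n r ^ (-m))) ?_ ?_ ?_
    (h.tendsto_f_zero hm ha hf.1) (tendsto_rho_rpow_neg n (by linarith)) ?_
  · filter_upwards [eventually_gt_atTop 0] with r hr using
      h.hasDerivAt_f_of_nonneg hm hr (h.v_pos_of_pos ha hf.1 hr).le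
  · filter_upwards [eventually_gt_atTop 0] with r hr
    refine ((hasDerivAt_rho n hr).rpow_const (Or.inl (rho_pos n hr).ne')).congr_deriv ?_
    rw [Real.rpow_sub_one (rho_pos n hr).ne']
    have := (rho_pos n hr).ne'
    field_simp
  · filter_upwards [eventually_gt_atTop 0] with r hr
    have := rho_pos n hr
    have : 0 < m * (1 + n / r) * rho n r ^ (-m) := by positivity
    exact (neg_lt_zero.2 this).ne
  · have h1 := (hlim.rpow_const (p := m) (Or.inl hl.ne')).div
      ((tendsto_drift n).const_mul m) (by positivity)
    refine h1.congr' ?_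
    filter_upwards [eventually_gt_atTop 0] with r hr
    have hρ := rho_pos n hr
    have hv := h.v_pos_of_pos ha hf.1 hr
    have hρm := Real.rpow_pos_of_pos hρ m
    rw [Pi.div_apply, Real.mul_rpow hρ.le hv.le, Real.rpow_neg hρ.le, neg_div_neg_eq]
    field_simp

/-- In the invariant region the ratio `z = v / f` solves `z' = 1 - z - (n / r) z + v ^ (m - 1) z²`
and is bounded, which forces `z → 1`. -/
lemma tendsto_div_one (hm : 1 < m) (h : IsFlow n m a f v) (ha : 0 < a)
    (hpos : ∀ s, 0 ≤ s → 0 < f s) {σ : ℝ} (hσ : 0 < σ)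
    (hle : ∀ᶠ r in atTop, σ * v r ≤ f r) : Tendsto (fun r => v r / f r) atTop (𝓝 1) := by
  have hf0 := h.tendsto_f_zero hm ha hpos
  have hzle : ∀ᶠ r in atTop, v r / f r ∈ Icc 0 (1 / σ) := by
    filter_upwards [hle, eventually_gt_atTop 0] with r h1 h2
    have hf := hpos r h2.le
    refine ⟨div_nonneg (h.v_pos_of_pos ha hpos h2).le hf.le, ?_⟩
    rw [div_le_div_iff₀ hf hσ]; linarith
  have hv0 : Tendsto v atTop (𝓝 0) := by
    refine squeeze_zero' ?_ ?_ (g := fun r => f r / σ) (by simpa using hf0.div_const σ)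
    · filter_upwards [eventually_gt_atTop 0] with r hr using (h.v_pos_of_pos ha hpos hr).le
    · filter_upwards [hle] with r hr
      rw [le_div_iff₀ hσ]; linarith
  have hvm : Tendsto (fun r => v r ^ (m - 1)) atTop (𝓝 0) := by
    have := hv0.rpow_const (p := m - 1) (Or.inr (by linarith))
    rwa [Real.zero_rpow (by linarith)] at this
  set G : ℝ → ℝ := fun r => (v r / f r) ^ 2 * v r ^ (m - 1) - n / r * (v r / f r) with hG
  have hbd : ∀ᶠ r in atTop, |v r / f r| ≤ 1 / σ := hzle.mono fun r hr => by
    rw [abs_of_nonneg hr.1]; exact hr.2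
  have hGlim : Tendsto G atTop (𝓝 0) := by
    have hbO : IsBoundedUnder (· ≤ ·) atTop (norm ∘ fun r => v r / f r) :=
      ⟨1 / σ, eventually_map.2 hbd⟩
    have hbO2 : IsBoundedUnder (· ≤ ·) atTop (norm ∘ fun r => (v r / f r) ^ 2) := by
      refine ⟨(1 / σ) ^ 2, ?_⟩
      rw [eventually_map]
      filter_upwards [hbd] with r hr
      simp only [Function.comp, norm_pow, Real.norm_eq_abs]
      gcongr
    have h1 := hvm.zero_mul_isBoundedUnder_le hbO2
    have h2 := ((tendsto_const_nhds (x := (n : ℝ))).div_atTop tendsto_id).zero_mul_isBoundedUnder_le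
      hbO
    simpa [hG, mul_comm] using h1.sub h2
  have hd : ∀ r, 0 < r → HasDerivAt (fun r => (v r / f r - 1) ^ 2)
      (2 * (v r / f r - 1) * (-(v r / f r - 1) + G r)) r := fun r hr => by
    have hv := h.v_pos_of_pos ha hpos hr
    have hf := hpos r hr.le
    refine ((((h.deriv_v r hr).div (h.hasDerivAt_f_of_nonneg hm hr hv.le) hf.ne').sub_const
      1).pow 2).congr_deriv ?_
    have e : v r ^ m = v r ^ (m - 1) * v r := by rw [← Real.rpow_add_one hv.ne']; simp
    simp only [hG, Pi.div_apply, e, abs_of_pos hv, Nat.cast_ofNat, Nat.reduceSub, pow_one]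
    field_simp
    ring
  have hsq : Tendsto (fun r => (v r / f r - 1) ^ 2) atTop (𝓝 0) := by
    refine Metric.tendsto_nhds.2 fun ε hε => ?_
    have h1 : Tendsto (fun r => G r ^ 2) atTop (𝓝 0) := by simpa using hGlim.pow 2
    obtain ⟨r₀, hr₀⟩ := eventually_atTop.1
      ((h1.eventually_lt_const (by positivity : 0 < ε / 4)).and (eventually_gt_atTop 0))
    have := eventually_le_of_deriv_le (k := 1) (δ := ε / 4) (ε := ε / 4) one_pos
      (fun r hr => hd r (hr₀ r hr).2) (r₀ := r₀) (fun r hr => by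
        have := (hr₀ r hr).1
        nlinarith [sq_nonneg (v r / f r - 1 - G r)]) (by positivity)
    filter_upwards [this] with r hr
    rw [Real.dist_eq, sub_zero, abs_of_nonneg (sq_nonneg _)]
    linarith
  have h2 : Tendsto (fun r => v r / f r - 1) atTop (𝓝 0) := by
    have := hsq.sqrt
    simp only [Real.sqrt_sq_eq_abs, Real.sqrt_zero] at this
    exact tendsto_zero_iff_abs_tendsto_zero _ |>.2 this
  simpa using h2.add_const 1

lemma isEquivalent_of_entersRegion (hm : 1 < m) (h : IsFlow n m a f v) (ha : 0 < a)
    (hE : EntersRegion m f v) :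
    Asymptotics.IsEquivalent atTop f (fun r => ((m - 1) * r) ^ (-(1 / (m - 1)))) := by
  have hpos := h.pos_of_entersRegion hm ha hE
  obtain ⟨r₁, hr₁, hp, hle, hs⟩ := hE
  have hreg := (h.pos_and_le_of_region hm ha (slowRatio_pos hm) hr₁ hp hle.le hs).2
  have hz := h.tendsto_div_one hm ha hpos (slowRatio_pos hm)
    (eventually_atTop.2 ⟨r₁, hreg⟩)
  have hm1 : 0 < m - 1 := by linarith
  have hzm : Tendsto (fun r => (m - 1) * (v r / f r) ^ m) atTop (𝓝 (m - 1)) := by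
    simpa using (hz.rpow_const (p := m) (Or.inl one_ne_zero)).const_mul (m - 1)
  have hlim := tendsto_div_of_deriv (y := fun r => f r ^ (1 - m)) (by
    filter_upwards [eventually_gt_atTop 0] with r hr
    have hv := h.v_pos_of_pos ha hpos hr
    have hf := hpos r hr.le
    refine ((h.hasDerivAt_f_of_nonneg hm hr hv.le).rpow_const (Or.inl hf.ne')).congr_deriv ?_
    rw [Real.div_rpow hv.le hf.le, show 1 - m - 1 = -m by ring, Real.rpow_neg hf.le]
    ring) hzm
  refine Asymptotics.isEquivalent_of_tendsto_one ?_
  have h1 := ((hlim.div_const (m - 1)).rpow_const (p := -(1 / (m - 1)))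
    (Or.inl (by rw [div_self hm1.ne']; exact one_ne_zero)))
  rw [div_self hm1.ne', Real.one_rpow] at h1
  refine h1.congr' ?_
  filter_upwards [eventually_gt_atTop 0] with r hr
  have hf := hpos r hr.le
  rw [Pi.div_apply, div_div, mul_comm r, Real.div_rpow (Real.rpow_nonneg hf.le _) (by positivity),
    ← Real.rpow_mul hf.le]
  congr 1
  rw [show (1 - m) * -(1 / (m - 1)) = 1 by field_simp; ring, Real.rpow_one]

end IsFlow

/-! ### The Pohozaev functional -/

/-- The primitive of the weight `ρ` vanishing at the origin. -/
noncomputable def rhoInt (n : ℕ) (r : ℝ) : ℝ := ∫ s in (0 : ℝ)..r, rho n s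

lemma hasDerivAt_rhoInt (n : ℕ) (r : ℝ) : HasDerivAt (rhoInt n) (rho n r) r :=
  ((continuous_rho n).integral_hasStrictDerivAt 0 r).hasDerivAt

lemma continuous_rhoInt (n : ℕ) : Continuous (rhoInt n) :=
  continuous_iff_continuousAt.2 fun r => (hasDerivAt_rhoInt n r).continuousAt

lemma rhoInt_zero (n : ℕ) : rhoInt n 0 = 0 := by simp [rhoInt]

lemma rhoInt_pos (n : ℕ) {r : ℝ} (hr : 0 < r) : 0 < rhoInt n r :=
  intervalIntegral.intervalIntegral_pos_of_pos_on ((continuous_rho n).intervalIntegrable _ _)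
    (fun _ hx => rho_pos n hx.1) hr

/-- The bound that makes `∫ρ · ρ' / ρ²` increasing. -/
lemma rhoInt_lt (n : ℕ) {r : ℝ} (hr : 0 < r) :
    rhoInt n r < rho n r * (r * (r + n) / ((r + n) ^ 2 + n)) := by
  rcases n.eq_zero_or_pos with rfl | hn
  · have h1 : rhoInt 0 r = Real.exp r - 1 := by simp [rhoInt, rho]
    have h2 : r * (r + (0 : ℕ)) / ((r + (0 : ℕ)) ^ 2 + (0 : ℕ)) = 1 := by
      simp only [Nat.cast_zero, add_zero]
      field_simp
    rw [h1, h2]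
    simp [rho]
  · have hn' : (0 : ℝ) < n := by exact_mod_cast hn
    have hD : ∀ x : ℝ, 0 < (x + n) ^ 2 + n := fun x => by positivity
    have hmono : StrictMonoOn
        (fun r => rho n r * (r * (r + n) / ((r + n) ^ 2 + n)) - rhoInt n r) (Ici 0) := by
      refine strictMonoOn_of_hasDerivAt
        (F' := fun r => rho n r * (2 * r * n / ((r + n) ^ 2 + n) ^ 2)) (convex_Ici 0) ?_ ?_ ?_
      · have h1 := continuous_rho n
        have h2 := continuous_rhoInt n
        have h3 : Continuous fun r : ℝ => r * (r + n) / ((r + n) ^ 2 + n) :=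
          (by fun_prop : Continuous fun r : ℝ => r * (r + n)).div (by fun_prop)
            fun x => (hD x).ne'
        fun_prop
      · intro x hx
        rw [interior_Ici] at hx
        have hx : 0 < x := hx
        have hx1 := (hasDerivAt_id x).add_const (n : ℝ)
        have hq := ((hasDerivAt_id x).mul hx1).div ((hx1.pow 2).add_const (n : ℝ)) (hD x).ne'
        refine (((hasDerivAt_rho n hx).mul hq).sub (hasDerivAt_rhoInt n x)).congr_deriv ?_
        have := (hD x).ne'
        simp only [id, Pi.mul_apply, Pi.div_apply, Pi.pow_apply, Nat.cast_ofNat, Nat.reduceSub, pow_one]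
        field_simp
        ring
      · intro x hx
        rw [interior_Ici] at hx
        have hx : 0 < x := hx
        exact mul_pos (rho_pos n hx) (div_pos (by positivity) (pow_pos (hD x) 2))
    have := hmono self_mem_Ici hr.le hr
    simp only [rhoInt_zero] at this
    have h0 : rho n 0 = 0 := by simp [rho, hn.ne']
    rw [h0] at this
    linarith

lemma rhoInt_le_rho (n : ℕ) {r : ℝ} (hr : 0 < r) : rhoInt n r ≤ rho n r := by
  refine (rhoInt_lt n hr).le.trans (mul_le_of_le_one_right (rho_nonneg n hr.le) ?_)
  have : (0 : ℝ) ≤ n := n.cast_nonneg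
  rw [div_le_one (by positivity)]
  nlinarith

/-- The Pohozaev functional `∫ρ · (f² + 2 / (m + 1) v ^ (m + 1)) - ρ v f`. Its derivative along
positive solutions is a multiple of `v ^ (m + 1)`, with no other terms. -/
noncomputable def pohozaev (n : ℕ) (m : ℝ) (f v : ℝ → ℝ) (r : ℝ) : ℝ :=
  rhoInt n r * (f r ^ 2 + 2 / (m + 1) * v r ^ (m + 1)) - rho n r * v r * f r

/-- The coefficient of `ρ v ^ (m + 1)` in the derivative of the Pohozaev functional. -/
noncomputable def pohozaevCoeff (n : ℕ) (m : ℝ) (r : ℝ) : ℝ :=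
  (m + 3) / (m + 1) - 2 * (rhoInt n r * (1 + n / r) / rho n r)

lemma strictAntiOn_pohozaevCoeff (n : ℕ) (m : ℝ) : StrictAntiOn (pohozaevCoeff n m) (Ioi 0) := by
  have hd : ∀ r : ℝ, 0 < r → HasDerivAt (pohozaevCoeff n m)
      (-(2 * ((rho n r * (1 + n / r) - rhoInt n r * ((1 + n / r) ^ 2 + n / r ^ 2)) / rho n r)))
      r := fun r hr => by
    have hρ := (rho_pos n hr).ne'
    have hL : HasDerivAt (fun r : ℝ => 1 + (n : ℝ) / r) (-(n / r ^ 2)) r := by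
      refine ((hasDerivAt_const r (n : ℝ)).div (hasDerivAt_id r) hr.ne').const_add 1
        |>.congr_deriv ?_
      simp
      ring
    refine (((((hasDerivAt_rhoInt n r).mul hL).div (hasDerivAt_rho n hr) hρ).const_mul 2).const_sub
      ((m + 3) / (m + 1))).congr_deriv ?_
    simp only [Pi.mul_apply]
    field_simp
    ring
  refine strictAntiOn_of_hasDerivAt (convex_Ioi 0)
    (fun r hr => (hd r hr).continuousAt.continuousWithinAt)
    (fun r hr => hd r (interior_subset hr)) fun r hr => ?_
  have hr : 0 < r := interior_subset hr
  have hρ := rho_pos n hr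
  have hn0 : (0 : ℝ) ≤ n := n.cast_nonneg
  have h1 := rhoInt_lt n hr
  have h2 : rhoInt n r * ((1 + n / r) ^ 2 + n / r ^ 2) < rho n r * (1 + n / r) := by
    have e1 : (1 + n / r) ^ 2 + n / r ^ 2 = ((r + n) ^ 2 + n) / r ^ 2 := by field_simp
    have hD : 0 < (r + n) ^ 2 + (n : ℝ) := by positivity
    rw [e1]
    have h3 := mul_lt_mul_of_pos_right h1 (div_pos hD (pow_pos hr 2))
    refine h3.trans_eq ?_
    field_simp
  have : 0 < (rho n r * (1 + n / r) - rhoInt n r * ((1 + n / r) ^ 2 + n / r ^ 2)) / rho n r :=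
    div_pos (by linarith) hρ
  linarith

namespace IsFlow

variable {n : ℕ} {m a b : ℝ} {f v g w : ℝ → ℝ}

lemma pohozaev_zero (h : IsFlow n m a f v) : pohozaev n m f v 0 = 0 := by
  simp [pohozaev, rhoInt_zero, h.v_zero]

lemma continuousOn_pohozaev (hm : 1 < m) (h : IsFlow n m a f v) :
    ContinuousOn (pohozaev n m f v) (Ici 0) := by
  have h1 := continuous_rho n
  have h2 := continuous_rhoInt n
  have h3 := h.continuousOn_f
  have h4 := h.continuousOn_v
  have h5 := h4.rpow_const (p := m + 1) fun x _ => Or.inr (by linarith)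
  unfold pohozaev
  fun_prop

lemma hasDerivAt_pohozaev (hm : 1 < m) (h : IsFlow n m a f v) {r : ℝ} (hr : 0 < r)
    (hv : 0 < v r) :
    HasDerivAt (pohozaev n m f v) (rho n r * v r ^ (m + 1) * pohozaevCoeff n m r) r := by
  have hf := h.hasDerivAt_f_of_nonneg hm hr hv.le
  have hvd := (h.deriv_v r hr).rpow_const (p := m + 1) (Or.inl hv.ne')
  refine (((hasDerivAt_rhoInt n r).mul ((hf.pow 2).add (hvd.const_mul (2 / (m + 1))))).sub
    ((h.hasDerivAt_rho_mul hr hv.le).mul hf)).congr_deriv ?_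
  have e : v r ^ (m + 1) = v r ^ m * v r := Real.rpow_add_one hv.ne' m
  have hρ := (rho_pos n hr).ne'
  simp only [Pi.add_apply, Pi.pow_apply, pohozaevCoeff, abs_of_pos hv, add_sub_cancel_right, e,
    Nat.cast_ofNat, Nat.reduceSub, pow_one]
  have : m + 1 ≠ 0 := by linarith
  field_simp
  ring

lemma _root_.IsFast.tendsto_pohozaev (hm : 1 < m) (h : IsFlow n m a f v) (ha : 0 < a)
    (hf : IsFast n f v) : Tendsto (pohozaev n m f v) atTop (𝓝 0) := by
  obtain ⟨l, hl, hlim⟩ := IsFast.tendsto_rho_mul h ha hf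
  obtain ⟨c, hc, hclim⟩ := IsFast.tendsto_div hm h ha hf
  have hf0 := h.tendsto_f_zero hm ha hf.1
  have h1 : Tendsto (fun r => rhoInt n r * f r ^ 2) atTop (𝓝 0) := by
    have := (hclim.mul (tendsto_rho_rpow_neg n (by linarith : 0 < m - 1))).mul hf0
    simp only [mul_zero] at this
    refine squeeze_zero' ?_ ?_ this
    · filter_upwards [eventually_gt_atTop 0] with r hr
      exact mul_nonneg (rhoInt_pos n hr).le (sq_nonneg _)
    · filter_upwards [eventually_gt_atTop 0] with r hr
      refine (mul_le_mul_of_nonneg_right (rhoInt_le_rho n hr) (sq_nonneg _)).trans_eq ?_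
      have hρ := rho_pos n hr
      have hρm := Real.rpow_pos_of_pos hρ m
      rw [show -(m - 1) = -m + 1 by ring, Real.rpow_add_one hρ.ne', Real.rpow_neg hρ.le]
      field_simp
  have h2 : Tendsto (fun r => rhoInt n r * v r ^ (m + 1)) atTop (𝓝 0) := by
    have := (hlim.rpow_const (p := m + 1) (Or.inl hl.ne')).mul
      (tendsto_rho_rpow_neg n (by linarith : 0 < m))
    rw [mul_zero] at this
    refine squeeze_zero' ?_ ?_ this
    · filter_upwards [eventually_gt_atTop 0] with r hr
      exact mul_nonneg (rhoInt_pos n hr).le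
        (Real.rpow_nonneg (h.v_pos_of_pos ha hf.1 hr).le _)
    · filter_upwards [eventually_gt_atTop 0] with r hr
      have hv := h.v_pos_of_pos ha hf.1 hr
      refine (mul_le_mul_of_nonneg_right (rhoInt_le_rho n hr)
        (Real.rpow_nonneg hv.le _)).trans_eq ?_
      have hρ := rho_pos n hr
      have hρm := Real.rpow_pos_of_pos hρ m
      rw [Real.mul_rpow hρ.le hv.le, Real.rpow_add_one hρ.ne', Real.rpow_neg hρ.le]
      field_simp
  have h3 := (h1.add (h2.const_mul (2 / (m + 1)))).sub (hlim.mul hf0)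
  simp only [mul_zero, add_zero, sub_zero] at h3
  refine h3.congr fun r => ?_
  rw [pohozaev]; ring

/-- The Pohozaev functional of a fast decaying solution increases from `0` and then decreases
to `0`. -/
lemma _root_.IsFast.pohozaev_pos (hm : 1 < m) (h : IsFlow n m a f v) (ha : 0 < a)
    (hf : IsFast n f v) {r : ℝ} (hr : 0 < r) : 0 < pohozaev n m f v r := by
  have hv : ∀ x, 0 < x → 0 < v x := fun x hx => h.v_pos_of_pos ha hf.1 hx
  have hpos : ∀ x, 0 < x → 0 < rho n x * v x ^ (m + 1) := fun x hx =>
    mul_pos (rho_pos n hx) (Real.rpow_pos_of_pos (hv x hx) _)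
  have hanti := strictAntiOn_pohozaevCoeff n m
  have hc := h.continuousOn_pohozaev hm
  rcases le_or_gt 0 (pohozaevCoeff n m r) with hcoef | hcoef
  · have hmono : StrictMonoOn (pohozaev n m f v) (Icc 0 r) := by
      refine strictMonoOn_of_hasDerivAt (convex_Icc 0 r) (hc.mono fun x hx => hx.1)
        (fun x hx => h.hasDerivAt_pohozaev hm (by rw [interior_Icc] at hx; exact hx.1)
          (hv x (by rw [interior_Icc] at hx; exact hx.1))) fun x hx => ?_
      rw [interior_Icc] at hx
      exact mul_pos (hpos x hx.1) (hcoef.trans_lt (hanti hx.1 hr hx.2))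
    have := hmono (left_mem_Icc.2 hr.le) (right_mem_Icc.2 hr.le) hr
    rwa [h.pohozaev_zero] at this
  · have hanti2 : StrictAntiOn (pohozaev n m f v) (Ici r) := by
      refine strictAntiOn_of_hasDerivAt (convex_Ici r) (hc.mono fun x hx => hr.le.trans hx)
        (fun x hx => h.hasDerivAt_pohozaev hm (hr.trans_le (interior_subset hx))
          (hv x (hr.trans_le (interior_subset hx)))) fun x hx => ?_
      rw [interior_Ici] at hx
      have hx : r < x := hx
      exact mul_neg_of_pos_of_neg (hpos x (hr.trans hx))
        ((hanti hr (hr.trans hx) hx).trans hcoef)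
    have h1 : 0 ≤ pohozaev n m f v (r + 1) := by
      refine le_of_tendsto (IsFast.tendsto_pohozaev hm h ha hf) ?_
      filter_upwards [eventually_ge_atTop (r + 1)] with x hx
      exact hanti2.antitoneOn (mem_Ici.2 (by linarith)) (mem_Ici.2 (by linarith)) hx
    exact h1.trans_lt (hanti2 self_mem_Ici (mem_Ici.2 (by linarith)) (by linarith))

lemma rhoInt_mul_lt (hm : 1 < m) (h : IsFlow n m a f v) (ha : 0 < a)
    (hpos : ∀ s, 0 ≤ s → 0 < f s) {r : ℝ} (hr : 0 < r) :
    rhoInt n r * f r < rho n r * v r := by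
  have hmono : StrictMonoOn (fun r => rho n r * v r - rhoInt n r * f r) (Ici 0) := by
    refine strictMonoOn_of_hasDerivAt (F' := fun r => rhoInt n r * v r ^ m) (convex_Ici 0)
      ?_ ?_ ?_
    · have h1 := continuous_rho n
      have h2 := continuous_rhoInt n
      have h3 := h.continuousOn_f
      have h4 := h.continuousOn_v
      fun_prop
    · intro x hx
      rw [interior_Ici] at hx
      have hv := h.v_pos_of_pos ha hpos hx
      exact ((h.hasDerivAt_rho_mul hx hv.le).sub ((hasDerivAt_rhoInt n x).mul
        (h.hasDerivAt_f_of_nonneg hm hx hv.le))).congr_deriv (by ring)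
    · intro x hx
      rw [interior_Ici] at hx
      exact mul_pos (rhoInt_pos n hx) (Real.rpow_pos_of_pos (h.v_pos_of_pos ha hpos hx) m)
  have := hmono self_mem_Ici hr.le hr
  simp only [h.v_zero, rhoInt_zero, mul_zero, zero_mul, sub_zero] at this
  linarith

end IsFlow

/-! ### Comparison with a fast decaying solution -/

lemma sign_mul_rpow_sub {s x y k : ℝ} (hs : s = 1 ∨ s = -1) (hx : 0 ≤ x) (hy : 0 ≤ y) (hk : 0 < k)
    (h : 0 < s * (x - y)) : 0 < s * (x ^ k - y ^ k) := by
  rcases hs with rfl | rfl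
  · have := Real.rpow_lt_rpow hy (by linarith : y < x) hk
    linarith
  · have := Real.rpow_lt_rpow hx (by linarith : x < y) hk
    linarith

/-- The Wronskian-type quantity governing the monotonicity of the ratio `w / v`. -/
def cross (f v g w : ℝ → ℝ) (r : ℝ) : ℝ := g r * v r - f r * w r

/-- The Pohozaev functional of the fast decaying solution `(f, v)`, rescaled by the ratio `w / v`,
minus the one of `(g, w)`. -/
noncomputable def pohozaevGap (n : ℕ) (m : ℝ) (f v g w : ℝ → ℝ) (r : ℝ) : ℝ :=
  (w r / v r) ^ (m + 1) * pohozaev n m f v r - pohozaev n m g w r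

namespace IsFlow

variable {n : ℕ} {m a b : ℝ} {f v g w : ℝ → ℝ}

lemma hasDerivAt_ratio (h : IsFlow n m a f v) (k : IsFlow n m b g w) {r : ℝ} (hr : 0 < r)
    (hv : 0 < v r) (hw : 0 < w r) :
    HasDerivAt (fun r => w r / v r) (cross f v g w r / v r ^ 2) r := by
  refine ((k.deriv_v r hr).div (h.deriv_v r hr) hv.ne').congr_deriv ?_
  rw [abs_of_pos hv, abs_of_pos hw, cross]
  congr 1
  ring

lemma hasDerivAt_rho_mul_cross (hm : 1 < m) (h : IsFlow n m a f v) (k : IsFlow n m b g w) {r : ℝ}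
    (hr : 0 < r) (hv : 0 < v r) (hw : 0 < w r) :
    HasDerivAt (fun r => g r * (rho n r * v r) - f r * (rho n r * w r))
      (rho n r * (v r * w r * (v r ^ (m - 1) - w r ^ (m - 1)))) r := by
  refine (((k.hasDerivAt_f_of_nonneg hm hr hw.le).mul (h.hasDerivAt_rho_mul hr hv.le)).sub
    ((h.hasDerivAt_f_of_nonneg hm hr hv.le).mul (k.hasDerivAt_rho_mul hr hw.le))).congr_deriv ?_
  have e1 : v r ^ m = v r ^ (m - 1) * v r := by rw [← Real.rpow_add_one hv.ne']; simp
  have e2 : w r ^ m = w r ^ (m - 1) * w r := by rw [← Real.rpow_add_one hw.ne']; simp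
  rw [e1, e2]
  ring

/-- The terms involving the Pohozaev coefficient cancel, because they are homogeneous. -/
lemma hasDerivAt_pohozaevGap (hm : 1 < m) (h : IsFlow n m a f v) (k : IsFlow n m b g w) {r : ℝ}
    (hr : 0 < r) (hv : 0 < v r) (hw : 0 < w r) :
    HasDerivAt (pohozaevGap n m f v g w)
      ((m + 1) * (w r / v r) ^ m * (cross f v g w r / v r ^ 2) * pohozaev n m f v r) r := by
  have hq : 0 < w r / v r := div_pos hw hv
  refine ((((h.hasDerivAt_ratio k hr hv hw).rpow_const (p := m + 1) (Or.inl hq.ne')).mul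
    (h.hasDerivAt_pohozaev hm hr hv)).sub (k.hasDerivAt_pohozaev hm hr hw)).congr_deriv ?_
  have e : (w r / v r) ^ (m + 1) * v r ^ (m + 1) = w r ^ (m + 1) := by
    rw [← Real.mul_rpow hq.le hv.le, div_mul_cancel₀ _ hv.ne']
  rw [← e, add_sub_cancel_right]
  ring

lemma tendsto_ratio_zero (h : IsFlow n m a f v) (ha : 0 < a) (k : IsFlow n m b g w) :
    Tendsto (fun r => w r / v r) (𝓝[>] 0) (𝓝 (b / a)) := by
  have h1 := k.tendsto_v_div.div h.tendsto_v_div (by positivity)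
  have e : b / (n + 1) / (a / (n + 1)) = b / a := by field_simp
  rw [e] at h1
  refine h1.congr' ?_
  filter_upwards [self_mem_nhdsWithin] with r hr
  have hr : 0 < r := hr
  simp only [Pi.div_apply]
  rw [div_div_div_cancel_right₀ hr.ne']

lemma tendsto_pohozaevGap_zero (hm : 1 < m) (h : IsFlow n m a f v) (ha : 0 < a)
    (k : IsFlow n m b g w) : Tendsto (pohozaevGap n m f v g w) (𝓝[>] 0) (𝓝 0) := by
  have key : ∀ {a f v}, IsFlow n m a f v →
      Tendsto (pohozaev n m f v) (𝓝[>] 0) (𝓝 0) := fun {a f v} h => by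
    have := ((h.continuousOn_pohozaev hm) 0 self_mem_Ici).mono Ioi_subset_Ici_self
    rwa [ContinuousWithinAt, h.pohozaev_zero] at this
  have := (((h.tendsto_ratio_zero ha k).rpow_const (p := m + 1)
    (Or.inr (by linarith))).mul (key h)).sub (key k)
  rw [mul_zero, sub_zero] at this
  exact this

lemma continuousOn_cross (h : IsFlow n m a f v) (k : IsFlow n m b g w) :
    ContinuousOn (cross f v g w) (Ici 0) :=
  (k.continuousOn_f.mul h.continuousOn_v).sub (h.continuousOn_f.mul k.continuousOn_v)

/-- As long as `w / v` stays on the side of `1` given by the sign `s`, the cross product has the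
opposite sign. -/
lemma sign_mul_cross_neg_of_ratio (hm : 1 < m) (h : IsFlow n m a f v) (k : IsFlow n m b g w)
    {s R : ℝ} (hs : s = 1 ∨ s = -1) (hR : 0 < R) (hv : ∀ x, 0 < x → x ≤ R → 0 < v x)
    (hw : ∀ x, 0 < x → x ≤ R → 0 < w x)
    (hq : ∀ x, 0 < x → x < R → 0 < s * (w x / v x - 1)) {r : ℝ} (hr : 0 < r) (hrR : r ≤ R) :
    s * cross f v g w r < 0 := by
  have hanti : StrictAntiOn (fun r => s * (g r * (rho n r * v r) - f r * (rho n r * w r)))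
      (Icc 0 R) := by
    refine strictAntiOn_of_hasDerivAt (F' := fun r =>
      s * (rho n r * (v r * w r * (v r ^ (m - 1) - w r ^ (m - 1))))) (convex_Icc 0 R) ?_ ?_ ?_
    · have hsub : Icc 0 R ⊆ Ici 0 := fun x hx => hx.1
      have h1 := h.continuousOn_f.mono hsub
      have h2 := h.continuousOn_v.mono hsub
      have h3 := k.continuousOn_f.mono hsub
      have h4 := k.continuousOn_v.mono hsub
      have h5 := continuous_rho n
      fun_prop
    · intro x hx
      rw [interior_Icc] at hx
      exact (h.hasDerivAt_rho_mul_cross hm k hx.1 (hv x hx.1 hx.2.le)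
        (hw x hx.1 hx.2.le)).const_mul s
    · intro x hx
      rw [interior_Icc] at hx
      have hvx := hv x hx.1 hx.2.le
      have hwx := hw x hx.1 hx.2.le
      have h1 : 0 < s * (w x - v x) := by
        have := mul_pos (hq x hx.1 hx.2) hvx
        rwa [mul_assoc, sub_mul, one_mul, div_mul_cancel₀ _ hvx.ne'] at this
      have h2 := sign_mul_rpow_sub hs hwx.le hvx.le (by linarith : 0 < m - 1) h1
      have h3 : 0 < rho n x * (v x * w x) := mul_pos (rho_pos n hx.1) (mul_pos hvx hwx)
      nlinarith [mul_pos h2 h3]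
  have := hanti (left_mem_Icc.2 hR.le) ⟨hr.le, hrR⟩ hr
  simp only [h.v_zero, k.v_zero, mul_zero, sub_zero] at this
  have h1 : s * (g r * (rho n r * v r) - f r * (rho n r * w r))
      = rho n r * (s * cross f v g w r) := by rw [cross]; ring
  rw [h1] at this
  exact neg_of_mul_neg_right this (rho_nonneg n hr.le)

/-- Let `(f, v)` decay fast. The ratio `w / v` to another solution `(g, w)` is strictly monotone as
long as `g` is positive: at a first critical point, the Pohozaev gap would have to have both
signs. -/
theorem _root_.IsFast.sign_mul_cross_neg (hm : 1 < m) (h : IsFlow n m a f v) (ha : 0 < a)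
    (hf : IsFast n f v) (k : IsFlow n m b g w) (hb : 0 < b) {s T : ℝ} (hs : s = 1 ∨ s = -1)
    (hab : 0 < s * (b - a)) (hpos : ∀ x, 0 ≤ x → x < T → 0 < g x) {r : ℝ} (hr : 0 < r)
    (hrT : r < T) : s * cross f v g w r < 0 := by
  by_contra! hcon
  have hv : ∀ x, 0 < x → 0 < v x := fun x hx => h.v_pos_of_pos ha hf.1 hx
  have hw : ∀ x, 0 < x → x ≤ T → 0 < w x := fun x hx hxT => k.v_pos hb hpos hx hxT
  have hss : s * s = 1 := by rcases hs with rfl | rfl <;> norm_num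
  -- near the origin the ratio is close to `b / a`
  have hnear : ∀ᶠ x in 𝓝[>] (0 : ℝ), 0 < s * (w x / v x - 1) := by
    refine (((h.tendsto_ratio_zero ha k).sub_const 1).const_mul s).eventually_const_lt ?_
    have e : b / a - 1 = (b - a) / a := by field_simp
    rw [e, ← mul_div_assoc]
    exact div_pos hab ha
  obtain ⟨δ, hδ, hδq⟩ := (mem_nhdsGT_iff_exists_Ioc_subset).1 hnear
  have hδ : 0 < δ := hδ
  have hδr : δ < r := by
    by_contra! hle
    exact absurd (h.sign_mul_cross_neg_of_ratio hm k hs hr (fun x hx _ => hv x hx)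
      (fun x hx hxr => hw x hx (hxr.trans hrT.le))
      (fun x hx hxr => hδq ⟨hx, hxr.le.trans hle⟩) hr le_rfl) (not_lt.2 hcon)
  have hδneg : ∀ x, 0 < x → x ≤ δ → s * cross f v g w x < 0 := fun x hx hxδ =>
    h.sign_mul_cross_neg_of_ratio hm k hs hδ (fun x hx _ => hv x hx)
      (fun x hx hxδ => hw x hx (hxδ.trans (hδr.trans hrT).le))
      (fun x hx hxδ => hδq ⟨hx, hxδ.le⟩) hx hxδ
  -- the first point `R` where the cross product vanishes
  have hcc : ContinuousOn (fun x => s * cross f v g w x) (Icc δ r) :=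
    continuousOn_const.mul ((h.continuousOn_cross k).mono fun x hx => hδ.le.trans hx.1)
  set S : Set ℝ := Icc δ r ∩ (fun x => s * cross f v g w x) ⁻¹' Ici 0 with hS
  have hSc : IsClosed S := hcc.preimage_isClosed_of_isClosed isClosed_Icc isClosed_Ici
  have hSb : BddBelow S := ⟨δ, fun x hx => hx.1.1⟩
  have hmem : sInf S ∈ S := hSc.csInf_mem ⟨r, ⟨hδr.le, le_rfl⟩, hcon⟩ hSb
  set R := sInf S with hR
  have hRge : 0 ≤ s * cross f v g w R := hmem.2
  have hδR : δ < R := by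
    refine lt_of_le_of_ne hmem.1.1 fun e => ?_
    have := hδneg δ hδ le_rfl
    rw [e] at this
    linarith
  have hR0 : 0 < R := hδ.trans hδR
  have hRT : R < T := hmem.1.2.trans_lt hrT
  have hbefore : ∀ x, 0 < x → x < R → s * cross f v g w x < 0 := fun x hx hxR => by
    rcases le_or_gt x δ with hxδ | hxδ
    · exact hδneg x hx hxδ
    · by_contra! hge
      exact notMem_of_lt_csInf hxR hSb ⟨⟨hxδ.le, hxR.le.trans hmem.1.2⟩, hge⟩
  have hvR := hv R hR0
  have hwR := hw R hR0 hRT.le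
  have hRzero : cross f v g w R = 0 := by
    have h1 : s * cross f v g w R ≤ 0 := by
      refine le_of_tendsto (((h.continuousOn_cross k).continuousAt
        (Ici_mem_nhds hR0)).tendsto.const_mul s |>.mono_left
          (nhdsWithin_le_nhds (s := Iio R))) ?_
      filter_upwards [Ioo_mem_nhdsLT hR0] with x hx using (hbefore x hx.1 hx.2).le
    have h2 : s * cross f v g w R = 0 := le_antisymm h1 hRge
    rcases mul_eq_zero.1 h2 with h3 | h3
    · rw [h3] at hss; norm_num at hss
    · exact h3
  -- there the ratio has passed the value `1`
  have hqR : s * (w R / v R - 1) < 0 := by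
    by_contra! hge
    have hanti : StrictAntiOn (fun x => s * (w x / v x)) (Ioc 0 R) := by
      refine strictAntiOn_of_hasDerivAt (F' := fun x => s * (cross f v g w x / v x ^ 2))
        (convex_Ioc 0 R) (fun x hx => ?_) (fun x hx => ?_) fun x hx => ?_
      · exact ((h.hasDerivAt_ratio k hx.1 (hv x hx.1)
          (hw x hx.1 (hx.2.trans hRT.le))).const_mul s).continuousAt.continuousWithinAt
      · rw [interior_Ioc] at hx
        exact (h.hasDerivAt_ratio k hx.1 (hv x hx.1) (hw x hx.1 (hx.2.trans hRT).le)).const_mul s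
      · rw [interior_Ioc] at hx
        rw [← mul_div_assoc]
        exact div_neg_of_neg_of_pos (hbefore x hx.1 hx.2) (pow_pos (hv x hx.1) 2)
    have := h.sign_mul_cross_neg_of_ratio hm k hs hR0 (fun x hx _ => hv x hx)
      (fun x hx hxr => hw x hx (hxr.trans hRT.le))
      (fun x hx hxr => by
        have := hanti ⟨hx, hxr.le⟩ ⟨hR0, le_rfl⟩ hxr
        simp only at this
        linarith) hR0 le_rfl
    linarith
  -- sign of the gap from its monotonicity
  have hgap : s * pohozaevGap n m f v g w R ≤ 0 := by
    have hanti : AntitoneOn (fun x => s * pohozaevGap n m f v g w x) (Ioc 0 R) := by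
      have hd : ∀ x ∈ Ioc 0 R, HasDerivAt (fun x => s * pohozaevGap n m f v g w x) (s *
          ((m + 1) * (w x / v x) ^ m * (cross f v g w x / v x ^ 2) * pohozaev n m f v x)) x :=
        fun x hx => (h.hasDerivAt_pohozaevGap hm k hx.1 (hv x hx.1)
          (hw x hx.1 (hx.2.trans hRT.le))).const_mul s
      refine antitoneOn_of_hasDerivAt (convex_Ioc 0 R)
        (fun x hx => (hd x hx).continuousAt.continuousWithinAt)
        (fun x hx => hd x (interior_subset hx)) fun x hx => ?_
      rw [interior_Ioc] at hx
      have h1 := (hbefore x hx.1 hx.2).le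
      have h2 := IsFast.pohozaev_pos hm h ha hf hx.1
      have h3 := Real.rpow_pos_of_pos (div_pos (hw x hx.1 (hx.2.trans hRT).le) (hv x hx.1)) m
      have h4 := hv x hx.1
      have e : s * ((m + 1) * (w x / v x) ^ m * (cross f v g w x / v x ^ 2) * pohozaev n m f v x)
          = (s * cross f v g w x) * ((m + 1) * (w x / v x) ^ m * pohozaev n m f v x / v x ^ 2) := by
        ring
      rw [e]
      exact mul_nonpos_of_nonpos_of_nonneg h1 (by positivity)
    have hlim := (h.tendsto_pohozaevGap_zero hm ha k).const_mul s
    rw [mul_zero] at hlim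
    refine ge_of_tendsto hlim ?_
    filter_upwards [Ioo_mem_nhdsGT hR0] with x hx using
      hanti ⟨hx.1, hx.2.le⟩ ⟨hR0, le_rfl⟩ hx.2.le
  -- sign of the gap from its value, the two solutions being proportional at `R`
  set q := w R / v R with hq
  have hq0 : 0 < q := div_pos hwR hvR
  have hwq : w R = q * v R := by rw [hq, div_mul_cancel₀ _ hvR.ne']
  have hgq : g R = q * f R := by
    rw [cross, hwq] at hRzero
    have : (g R - q * f R) * v R = 0 := by linear_combination hRzero
    rcases mul_eq_zero.1 this with h1 | h1
    · linarith
    · exact absurd h1 hvR.ne'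
  have hval : pohozaevGap n m f v g w R
      = (q ^ (m + 1) - q ^ 2) * (f R * (rhoInt n R * f R - rho n R * v R)) := by
    rw [pohozaevGap, ← hq, pohozaev, pohozaev, hgq, hwq, Real.mul_rpow hq0.le hvR.le]
    ring
  have h1 : 0 < f R * (rho n R * v R - rhoInt n R * f R) :=
    mul_pos (hf.1 R hR0.le) (by linarith [h.rhoInt_mul_lt hm ha hf.1 hR0])
  have h2 : 0 < s * (1 - q ^ (m - 1)) := by
    have := sign_mul_rpow_sub hs zero_le_one hq0.le (by linarith : 0 < m - 1)
      (by linarith : 0 < s * (1 - q))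
    rwa [Real.one_rpow] at this
  have h3 : q ^ (m + 1) = q ^ (m - 1) * q ^ 2 := by
    rw [← Real.rpow_natCast, ← Real.rpow_add hq0]
    congr 1; push_cast; ring
  rw [hval, h3] at hgap
  have h4 := mul_pos (mul_pos h2 (pow_pos hq0 2)) h1
  linarith

/-- There is at most one fast decaying solution: the Pohozaev gap of two of them would be strictly
monotone with limit `0` at both ends. -/
lemma _root_.IsFast.unique_aux (hm : 1 < m) (h : IsFlow n m a f v) (ha : 0 < a)
    (hf : IsFast n f v) (k : IsFlow n m b g w) (hb : 0 < b) {s : ℝ} (hs : s = 1 ∨ s = -1)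
    (hab : 0 < s * (b - a)) (hg : IsFast n g w) : False := by
  have hv : ∀ x, 0 < x → 0 < v x := fun x hx => h.v_pos_of_pos ha hf.1 hx
  have hw : ∀ x, 0 < x → 0 < w x := fun x hx => k.v_pos_of_pos hb hg.1 hx
  have hanti : StrictAntiOn (fun x => s * pohozaevGap n m f v g w x) (Ioi 0) := by
    have hd : ∀ x ∈ Ioi (0 : ℝ), HasDerivAt (fun x => s * pohozaevGap n m f v g w x) (s *
        ((m + 1) * (w x / v x) ^ m * (cross f v g w x / v x ^ 2) * pohozaev n m f v x)) x :=
      fun x hx => (h.hasDerivAt_pohozaevGap hm k hx (hv x hx) (hw x hx)).const_mul s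
    refine strictAntiOn_of_hasDerivAt (convex_Ioi 0)
      (fun x hx => (hd x hx).continuousAt.continuousWithinAt)
      (fun x hx => hd x (interior_subset hx)) fun x hx => ?_
    have hx : 0 < x := interior_subset hx
    have h1 := IsFast.sign_mul_cross_neg hm h ha hf k hb hs hab (T := x + 1)
      (fun y hy _ => hg.1 y hy) hx (by linarith)
    have h2 := IsFast.pohozaev_pos hm h ha hf hx
    have h3 := Real.rpow_pos_of_pos (div_pos (hw x hx) (hv x hx)) m
    have h4 := hv x hx
    have e : s * ((m + 1) * (w x / v x) ^ m * (cross f v g w x / v x ^ 2) * pohozaev n m f v x)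
        = (s * cross f v g w x) * ((m + 1) * (w x / v x) ^ m * pohozaev n m f v x / v x ^ 2) := by
      ring
    rw [e]
    exact mul_neg_of_neg_of_pos h1 (by positivity)
  have hlim0 := (h.tendsto_pohozaevGap_zero hm ha k).const_mul s
  rw [mul_zero] at hlim0
  have h1 : s * pohozaevGap n m f v g w 1 ≤ 0 := by
    refine ge_of_tendsto hlim0 ?_
    filter_upwards [Ioo_mem_nhdsGT one_pos] with x hx using
      (hanti hx.1 (mem_Ioi.2 one_pos) hx.2).le
  have hlim : Tendsto (fun x => s * pohozaevGap n m f v g w x) atTop (𝓝 0) := by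
    obtain ⟨l, hl, hl'⟩ := IsFast.tendsto_rho_mul h ha hf
    obtain ⟨l₂, hl₂, hl₂'⟩ := IsFast.tendsto_rho_mul k hb hg
    have hq : Tendsto (fun r => w r / v r) atTop (𝓝 (l₂ / l)) := by
      refine (hl₂'.div hl' hl.ne').congr' ?_
      filter_upwards [eventually_gt_atTop 0] with r hr
      rw [Pi.div_apply, mul_div_mul_left _ _ (rho_pos n hr).ne']
    have := (((hq.rpow_const (p := m + 1) (Or.inr (by linarith))).mul
      (IsFast.tendsto_pohozaev hm h ha hf)).sub (IsFast.tendsto_pohozaev hm k hb hg)).const_mul s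
    simpa [pohozaevGap] using this
  have h2 : 0 ≤ s * pohozaevGap n m f v g w 2 := by
    refine le_of_tendsto hlim ?_
    filter_upwards [eventually_gt_atTop 2] with x hx
    exact (hanti (mem_Ioi.2 two_pos) (mem_Ioi.2 (by linarith)) hx).le
  have h3 := hanti (mem_Ioi.2 one_pos) (mem_Ioi.2 two_pos) one_lt_two
  simp only at h3
  linarith

/-- Above the fast decaying solution there are no positive ones: the ratio `w / v` would be
decreasing, hence the solution would itself decay fast. -/
theorem _root_.IsFast.exists_nonpos_of_gt (hm : 1 < m) (h : IsFlow n m a f v) (ha : 0 < a)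
    (hf : IsFast n f v) (k : IsFlow n m b g w) (hab : a < b) : ∃ x, 0 ≤ x ∧ g x ≤ 0 := by
  by_contra! hpos
  have hb : 0 < b := ha.trans hab
  have hv : ∀ x, 0 < x → 0 < v x := fun x hx => h.v_pos_of_pos ha hf.1 hx
  have hw : ∀ x, 0 < x → 0 < w x := fun x hx => k.v_pos_of_pos hb hpos hx
  have hanti : AntitoneOn (fun x => w x / v x) (Ioi 0) := by
    have hd : ∀ x ∈ Ioi (0 : ℝ), HasDerivAt (fun x => w x / v x) (cross f v g w x / v x ^ 2) x :=
      fun x hx => h.hasDerivAt_ratio k hx (hv x hx) (hw x hx)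
    refine antitoneOn_of_hasDerivAt (convex_Ioi 0)
      (fun x hx => (hd x hx).continuousAt.continuousWithinAt)
      (fun x hx => hd x (interior_subset hx)) fun x hx => ?_
    have hx : 0 < x := interior_subset hx
    have h1 := IsFast.sign_mul_cross_neg hm h ha hf k hb (s := 1) (Or.inl rfl) (by linarith)
      (T := x + 1) (fun y hy _ => hpos y hy) hx (by linarith)
    rw [one_mul] at h1
    exact div_nonpos_of_nonpos_of_nonneg h1.le (sq_nonneg _)
  have hle : ∀ x, 0 < x → w x ≤ b / a * v x := fun x hx => by
    rw [← div_le_iff₀ (hv x hx)]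
    refine ge_of_tendsto (h.tendsto_ratio_zero ha k) ?_
    filter_upwards [Ioo_mem_nhdsGT hx] with y hy using hanti hy.1 hx hy.2.le
  obtain ⟨C, hC⟩ := hf.2
  refine IsFast.unique_aux hm h ha hf k hb (s := 1) (Or.inl rfl) (by linarith)
    ⟨hpos, b / a * C, fun r hr => ?_⟩
  rcases hr.eq_or_lt with rfl | hr
  · rw [k.v_zero, mul_zero]
    have := hC 0 le_rfl
    rw [h.v_zero, mul_zero] at this
    positivity
  · calc rho n r * w r ≤ rho n r * (b / a * v r) :=
          mul_le_mul_of_nonneg_left (hle r hr) (rho_nonneg n hr.le)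
      _ = b / a * (rho n r * v r) := by ring
      _ ≤ _ := mul_le_mul_of_nonneg_left (hC r hr.le) (by positivity)

/-- Below the fast decaying solution all solutions are positive and decay slowly. -/
theorem _root_.IsFast.entersRegion_of_lt (hm : 1 < m) (h : IsFlow n m a f v) (ha : 0 < a)
    (hf : IsFast n f v) (k : IsFlow n m b g w) (hb : 0 < b) (hba : b < a) :
    EntersRegion m g w := by
  have hpos : ∀ x, 0 ≤ x → 0 < g x := by
    by_contra! hcon
    obtain ⟨R, hR, hposR, hgR⟩ := k.exists_first_zero hb hcon
    have h1 : 0 ≤ cross f v g w R := by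
      refine ge_of_tendsto (((h.continuousOn_cross k).continuousAt
        (Ici_mem_nhds hR)).tendsto.mono_left (nhdsWithin_le_nhds (s := Iio R))) ?_
      filter_upwards [Ioo_mem_nhdsLT hR] with x hx
      have := IsFast.sign_mul_cross_neg hm h ha hf k hb (s := -1) (Or.inr rfl) (by linarith)
        hposR hx.1 hx.2
      linarith
    have h2 := mul_pos (hf.1 R hR.le) (k.v_pos hb hposR hR le_rfl)
    rw [cross, hgR, zero_mul] at h1
    linarith
  exact (k.isFast_or_entersRegion hm hb hpos).resolve_left fun hg =>
    IsFast.unique_aux hm h ha hf k hb (s := -1) (Or.inr rfl) (by linarith) hg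

end IsFlow

/-! ### Classification -/

lemma rho_rpow_neg {n : ℕ} {p r : ℝ} (hr : 0 < r) :
    rho n r ^ (-(1 / (p - 1)))
      = r ^ (-((((n + 1 : ℕ) : ℝ) - 1) / (p - 1))) * Real.exp (-(r / (p - 1))) := by
  rw [rho, Real.mul_rpow (pow_nonneg hr.le n) (Real.exp_pos r).le, ← Real.rpow_natCast,
    ← Real.rpow_mul hr.le, ← Real.exp_mul]
  congr 2
  · push_cast; ring
  · ring

/-- Exponential and algebraic decay are incompatible. -/
lemma not_isEquivalent_exp_rpow {c ℓ k j l : ℝ} (hℓ : 0 < ℓ) (hk : 0 < k) :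
    ¬ Asymptotics.IsEquivalent atTop (fun r : ℝ => c * r ^ j * Real.exp (-(r / k)))
      (fun r => (ℓ * r) ^ (-l)) := by
  intro h
  have hz : ∀ᶠ r : ℝ in atTop, (ℓ * r) ^ (-l) ≠ 0 := by
    filter_upwards [eventually_gt_atTop 0] with r hr
    exact (Real.rpow_pos_of_pos (mul_pos hℓ hr) _).ne'
  have h1 := (Asymptotics.isEquivalent_iff_tendsto_one hz).1 h
  have h2 : Tendsto (fun r : ℝ => c * ℓ ^ l * (r ^ (j + l) * Real.exp (-(1 / k) * r))) atTop
      (𝓝 0) := by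
    simpa using (tendsto_rpow_mul_exp_neg_mul_atTop_nhds_zero (j + l) (1 / k)
      (by positivity)).const_mul (c * ℓ ^ l)
  refine one_ne_zero (tendsto_nhds_unique h1 (h2.congr' ?_))
  filter_upwards [eventually_gt_atTop 0] with r hr
  rw [Pi.div_apply, Real.rpow_neg (mul_pos hℓ hr).le, div_inv_eq_mul, Real.mul_rpow hℓ.le hr.le,
    Real.rpow_add hr, show -(1 / k) * r = -(r / k) by ring]
  ring

lemma IsFast.isFastDecaying {n : ℕ} {p a : ℝ} {f v : ℝ → ℝ} (hp : 1 < p) (hp2 : p < 2)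
    (h : IsFlow n (1 / (p - 1)) a f v) (ha : 0 < a) (hf : IsFast n f v) :
    IsFastDecaying (n + 1) p f := by
  have hp1 : 0 < p - 1 := by linarith
  have hm : 1 < 1 / (p - 1) := by rw [lt_div_iff₀ hp1]; linarith
  obtain ⟨c, hc, hlim⟩ := IsFast.tendsto_div hm h ha hf
  refine ⟨hf.1, c, hc, Asymptotics.isEquivalent_of_tendsto_one ?_⟩
  have h1 := hlim.div_const c
  rw [div_self hc.ne'] at h1
  refine h1.congr' ?_
  filter_upwards [eventually_gt_atTop 0] with r hr
  rw [Pi.div_apply, mul_assoc c, ← rho_rpow_neg hr, div_div, mul_comm c]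

theorem theorem2p1 (N : ℕ) (hN : 1 ≤ N) (p : ℝ)
    (hpc : 2 * (N : ℝ) / ((N : ℝ) + 1) < p) (hp2 : p < 2) :
    ∃ f : ℝ → ℝ → ℝ,
      -- for each `a > 0`, `f a` is the unique solution
      (∀ a : ℝ, 0 < a →
        IsProfile N p a (f a) ∧
          ∀ g : ℝ → ℝ, IsProfile N p a g → EqOn g (f a) (Ici 0)) ∧
      ∃ aStar : ℝ, 0 < aStar ∧
        -- `aStar` is the unique parameter with a positive, fast decaying solution
        IsFastDecaying N p (f aStar) ∧
        (∀ b : ℝ, 0 < b → IsFastDecaying N p (f b) → b = aStar) ∧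
        -- (a) `a < aStar`
        (∀ a : ℝ, 0 < a → a < aStar →
          (∀ r : ℝ, 0 ≤ r → 0 < f a r) ∧
            Asymptotics.IsEquivalent atTop (f a)
              (fun r : ℝ => ((2 - p) / (p - 1) * r) ^ (-((p - 1) / (2 - p))))) ∧
        -- (b) `a > aStar`
        (∀ a : ℝ, aStar < a →
          (∃ R : ℝ, 0 < R ∧ (∀ r : ℝ, 0 < r → r < R → 0 < f a r) ∧
            f a R = 0 ∧ radialDeriv (f a) R < 0) ∧
          (∃ r s : ℝ, 0 < r ∧ 0 < s ∧ 0 < f a r ∧ f a s < 0)) := by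
  obtain ⟨n, rfl⟩ : ∃ n, N = n + 1 := ⟨N - 1, by omega⟩
  have hn : (0 : ℝ) ≤ n := n.cast_nonneg
  rw [div_lt_iff₀ (by positivity)] at hpc
  push_cast at hpc
  have hp : 1 < p := by nlinarith
  have hp1 : 0 < p - 1 := by linarith
  have hm : 1 < 1 / (p - 1) := by rw [lt_div_iff₀ hp1]; linarith
  have hnm : n * (1 / (p - 1)) < n + 2 := by
    rw [mul_one_div, div_lt_iff₀ hp1]; nlinarith
  choose F W hF using exists_isFlow n hm
  have e1 : 1 / (p - 1) - 1 = (2 - p) / (p - 1) := by field_simp; ring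
  have e2 : 1 / ((2 - p) / (p - 1)) = (p - 1) / (2 - p) := one_div_div _ _
  have hslow : ∀ a, 0 < a → EntersRegion (1 / (p - 1)) (F a) (W a) →
      Asymptotics.IsEquivalent atTop (F a)
        (fun r : ℝ => ((2 - p) / (p - 1) * r) ^ (-((p - 1) / (2 - p)))) := fun a ha hE => by
    have := (hF a).isEquivalent_of_entersRegion hm ha hE
    rwa [e1, e2] at this
  obtain ⟨A, hA, hfast⟩ := IsFlow.exists_isFast hm hnm hF
  have hbelow : ∀ a, 0 < a → a < A → EntersRegion (1 / (p - 1)) (F a) (W a) := fun a ha haA =>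
    IsFast.entersRegion_of_lt hm (hF A) hA hfast (hF a) ha haA
  have habove : ∀ a, A < a → ∃ x, 0 ≤ x ∧ F a x ≤ 0 := fun a haA =>
    IsFast.exists_nonpos_of_gt hm (hF A) hA hfast (hF a) haA
  refine ⟨F, fun a _ => ⟨(hF a).isProfile hp hp2, fun g hg => (hg.isFlow hp).eqOn hm (hF a)⟩,
    A, hA, hfast.isFastDecaying hp hp2 (hF A) hA, fun b hb hfb => ?_, fun a ha haA => ?_,
    fun a haA => ?_⟩
  · rcases lt_trichotomy b A with hbA | hbA | hbA
    · obtain ⟨c, -, hc⟩ := hfb.2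
      exact absurd (hc.symm.trans (hslow b hb (hbelow b hb hbA)))
        (not_isEquivalent_exp_rpow (div_pos (by linarith) hp1) hp1)
    · exact hbA
    · obtain ⟨x, hx, hFx⟩ := habove b hbA
      exact absurd (hfb.1 x hx) (not_lt.2 hFx)
  · have hE := hbelow a ha haA
    exact ⟨(hF a).pos_of_entersRegion hm ha hE, hslow a ha hE⟩
  · have ha : 0 < a := hA.trans haA
    obtain ⟨R, hR, hposR, hFR⟩ := (hF a).exists_first_zero ha (habove a haA)
    obtain ⟨s, hs, hFs⟩ := (hF a).exists_neg_of_zero hm ha hR hposR hFR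
    refine ⟨⟨R, hR, fun r hr hrR => hposR r hr.le hrR, hFR, ?_⟩, R / 2, s, by linarith,
      by linarith, hposR _ (by linarith) (by linarith), hFs⟩
    have hv := (hF a).v_pos ha hposR hR le_rfl
    rw [radialDeriv, ((hF a).deriv_f R hR.le).derivWithin (uniqueDiffOn_Ici 0 R hR.le),
      sPow_of_nonneg hm hv.le, neg_lt_zero]
    exact Real.rpow_pos_of_pos hv _
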